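/- Let $\mathcal G$ be a groupoid (a category in which every morphism is invertible); identify $\mathcal G$ with its set of morphisms, write $gh$ for the composite of $g\colon i\to j$ and $h\colon j\to k$, $\bar g$ for the inverse of $g$ and $1_i$ for the identity of $i$. A Hopf $\mathcal G$-algebra in a braided monoidal category (product $\diamond$, unit $\mathbf 1$, braiding $\gamma$, and $\bar\gamma_{A,B}=\gamma_{B,A}^{-1}\colon A\diamond B\to B\diamond A$; associativity morphisms are omitted) is a family of objects $H_g$, $g\in\mathcal G$, (the index $g$ stands for $H_g$ in $\mathrm{id}_g$, $\gamma_{g,h}$, $\bar\gamma_{g,h}$) with morphisms $\Delta_g\colon H_g\to H_g\diamond H_g$, $\epsilon_g\colon H_g\to\mathbf 1$, $m_{g,h}\colon H_g\diamond H_h\to H_{gh}$ (for composable $g,h$), $\eta_i\colon\mathbf 1\to H_{1_i}$, $S_g,\bar S_g\colon H_g\to H_{\bar g}$ such that, whenever the terms are defined and for $g\in\mathcal G(i,j)$ where $i,j$ occur, - $(\Delta_g\diamond\mathrm{id}_g)\Delta_g=(\mathrm{id}_g\diamond\Delta_g)\Delta_g$ and $(\epsilon_g\diamond\mathrm{id}_g)\Delta_g=\mathrm{id}_g=(\mathrm{id}_g\diamond\epsilon_g)\Delta_g$;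 - $m_{fg,h}(m_{f,g}\diamond\mathrm{id}_h)=m_{f,gh}(\mathrm{id}_f\diamond m_{g,h})$ and $m_{g,1_j}(\mathrm{id}_g\diamond\eta_j)=\mathrm{id}_g=m_{1_i,g}(\eta_i\diamond\mathrm{id}_g)$; - $(m_{g,h}\diamond m_{g,h})(\mathrm{id}_g\diamond\gamma_{g,h}\diamond\mathrm{id}_h)(\Delta_g\diamond\Delta_h)=\Delta_{gh}m_{g,h}$, $\ \epsilon_{gh}m_{g,h}=\epsilon_g\diamond\epsilon_h$, $\ \Delta_{1_i}\eta_i=\eta_i\diamond\eta_i$, $\ \epsilon_{1_i}\eta_i=\mathrm{id}_{\mathbf 1}$; - $m_{\bar g,g}(S_g\diamond\mathrm{id}_g)\Delta_g=\eta_j\epsilon_g$, $\ m_{g,\bar g}(\mathrm{id}_g\diamond S_g)\Delta_g=\eta_i\epsilon_g$, $\ S_{\bar g}\bar S_g=\mathrm{id}_g=\bar S_{\bar g}S_g$. It is unimodular, with cointegral $l_i\colon H_{1_i}\to\mathbf 1$ and integral $L_g\colon\mathbf 1\to H_g$, if $(\mathrm{id}_{1_i}\diamond l_i)\Delta_{1_i}=\eta_il_i=(l_i\diamond\mathrm{id}_{1_i})\Delta_{1_i}$,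 $\ m_{g,h}(L_g\diamond\mathrm{id}_h)=L_{gh}\epsilon_h$, $\ m_{g,h}(\mathrm{id}_g\diamond L_h)=L_{gh}\epsilon_g$, $\ l_iL_{1_i}=\mathrm{id}_{\mathbf 1}=l_iS_{1_i}L_{1_i}$, $\ S_gL_g=L_{\bar g}$ and $l_iS_{1_i}=l_i$. It is ribbon, with invertible ribbon morphisms $v_g\colon H_g\to H_g$, if it is unimodular and $\epsilon_gv_g=\epsilon_g$, $\ v_gL_g=L_g$, $\ S_gv_g=v_{\bar g}S_g$, $\ m_{g,h}(v_g\diamond\mathrm{id}_h)=v_{gh}m_{g,h}=m_{g,h}(\mathrm{id}_g\diamond v_h)$ and the following holds. Put $\sigma_{j,j}=(v_{1_j}^{-1}\diamond v_{1_j}^{-1}S_{1_j})\Delta_{1_j}v_{1_j}\eta_j$ and $\sigma_{i,j}=\eta_i\diamond\eta_j$ for $i\neq j$. For $g$ with target $i$ and $h$ with source $j$ put $$\mu_{g,h}=(m_{g,1_i}\diamond m_{1_j,h})(\mathrm{id}_g\diamond\sigma_{i,j}\diamond\mathrm{id}_h);$$ for $g$ with target $i$ and any object $k$ put $\rho^r_{g,k}=(m_{g,1_i}\diamond\mathrm{id}_{1_k})(\mathrm{id}_g\diamond\sigma_{i,k})$;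 for $h$ with source $j$ and any object $k$ put $\rho^l_{h,k}=(\mathrm{id}_{1_k}\diamond m_{1_j,h})(\sigma_{k,j}\diamond\mathrm{id}_h)$. Then: - $\sigma_{i,j}$ is a Hopf copairing for all $i,j$: $(\Delta_{1_i}\diamond\mathrm{id})\sigma_{i,j}=(\mathrm{id}\diamond\mathrm{id}\diamond m_{1_j,1_j})(\mathrm{id}\diamond\sigma_{i,j}\diamond\mathrm{id})\sigma_{i,j}$, $\ (\mathrm{id}\diamond\Delta_{1_j})\sigma_{i,j}=(m_{1_i,1_i}\diamond\mathrm{id}\diamond\mathrm{id})(\mathrm{id}\diamond\sigma_{i,j}\diamond\mathrm{id})\sigma_{i,j}$, $\ (\epsilon_{1_i}\diamond\mathrm{id})\sigma_{i,j}=\eta_j$, $\ (\mathrm{id}\diamond\epsilon_{1_j})\sigma_{i,j}=\eta_i$; - $\Delta_gv_g^{-1}=\mu_{g,g}(v_g^{-1}\diamond v_g^{-1})\bar\gamma_{g,g}\Delta_g$; - for $g$ with target $i$ and $h$ with source $j$, $\ (m_{1_j,h}\diamond m_{g,1_i})\bigl(S_{1_j}\diamond(\mu_{h,g}\bar\gamma_{g,h}\mu_{g,h})\diamond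 S_{1_i}\bigr)(\rho^l_{g,j}\diamond\rho^r_{h,i})=\gamma_{g,h}$. Let $\mathcal H^r(\mathcal G)$ be the free (strict) braided monoidal category with a ribbon Hopf $\mathcal G$-algebra: its objects are the finite sequences of elements of $\mathcal G$ (products of the $H_g$), and its morphisms are the iterated composites and products of identities, braidings and their inverses, and $m_{g,h},\eta_i,\Delta_g,\epsilon_g,S_g,\bar S_g,l_i,L_g,v_g,v_g^{-1}$, modulo the axioms of a strict braided monoidal category and of a ribbon Hopf $\mathcal G$-algebra. **Proposition.** Let $\phi\colon\mathcal G\to\mathcal G'$ be a functor between groupoids which is injective on objects. Then $\phi$ extends to a functor $\Upsilon_\phi\colon\mathcal H^r(\mathcal G)\to\mathcal H^r(\mathcal G')$; that is, there is a functor $\Upsilon_\phi$ with $\Upsilon_\phi(H_{g_1}\diamond\dots\diamond H_{g_n})=H_{\phi(g_1)}\diamond\dots\diamond H_{\phi(g_n)}$, which strictly preserves products and braidings and satisfies $\Upsilon_\phi(m_{g,h})=m_{\phi(g),\phi(h)}$, $\Upsilon_\phi(\eta_i)=\eta_{\phi(i)}$, and likewise for all the other structure morphisms. Moreover, if $\phi$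 is faithful, then $\Upsilon_\phi$ is faithful, and it is injective on objects; so it is an embedding of $\mathcal H^r(\mathcal G)$ in $\mathcal H^r(\mathcal G')$, in particular when $\mathcal G\subset\mathcal G'$ is a subgroupoid and $\phi$ is the inclusion. -/

import Mathlib

open CategoryTheory MonoidalCategory

set_option linter.unusedSimpArgs false

universe u v u' v'

namespace RibbonHopf

/-- An element of (the set of morphisms of) the groupoid `G`, together with its source and target.
The product `gh` in a groupoid is written from left to right, so it is `g ≫ h`. -/
@[ext]
structure Lab (G : Type u) [Groupoid.{v} G] where
  src : G
  tgt : G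
  hom : src ⟶ tgt

variable {G : Type u} [Groupoid.{v} G] {G' : Type u'} [Groupoid.{v'} G']

/-- The basic object `H_g`. -/
abbrev H {i j : G} (g : i ⟶ j) : Lab G := ⟨i, j, g⟩

/-- The image of a label under a functor of groupoids. -/
def Lab.map (φ : G ⥤ G') (a : Lab G) : Lab G' := ⟨φ.obj a.src, φ.obj a.tgt, φ.map a.hom⟩

/-- The elementary morphisms (other than identities and braidings) of the universal ribbon Hopf
`G`-algebra. -/
inductive Gen (G : Type u) [Groupoid.{v} G] : Type (max u v)
  /-- multiplication `m_{g,h} : H_g ⋄ H_h → H_{gh}`, for composable `g`, `h` -/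
  | mul {i j k : G} (g : i ⟶ j) (h : j ⟶ k) : Gen G
  /-- unit `η_i : 1 → H_{1_i}` -/
  | unit (i : G) : Gen G
  /-- comultiplication `Δ_g : H_g → H_g ⋄ H_g` -/
  | comul {i j : G} (g : i ⟶ j) : Gen G
  /-- counit `ε_g : H_g → 1` -/
  | counit {i j : G} (g : i ⟶ j) : Gen G
  /-- antipode `S_g : H_g → H_{g⁻¹}` -/
  | anti {i j : G} (g : i ⟶ j) : Gen G
  /-- inverse antipode, with components `H_g → H_{g⁻¹}` -/
  | antiInv {i j : G} (g : i ⟶ j) : Gen G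
  /-- cointegral `l_i : H_{1_i} → 1` -/
  | coint (i : G) : Gen G
  /-- integral `L_g : 1 → H_g` -/
  | integ {i j : G} (g : i ⟶ j) : Gen G
  /-- ribbon morphism `v_g : H_g → H_g` -/
  | rib {i j : G} (g : i ⟶ j) : Gen G
  /-- inverse ribbon morphism `v_g⁻¹ : H_g → H_g` -/
  | ribInv {i j : G} (g : i ⟶ j) : Gen G

/-- Source of an elementary morphism, as a sequence of labels. -/
def Gen.dom : Gen G → List (Lab G)
  | mul g h => [H g, H h]
  | unit _ => []
  | comul g => [H g]
  | counit g => [H g]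
  | anti g => [H g]
  | antiInv g => [H g]
  | coint i => [H (𝟙 i)]
  | integ _ => []
  | rib g => [H g]
  | ribInv g => [H g]

/-- Target of an elementary morphism, as a sequence of labels. -/
def Gen.cod : Gen G → List (Lab G)
  | mul g h => [H (g ≫ h)]
  | unit i => [H (𝟙 i)]
  | comul g => [H g, H g]
  | counit _ => []
  | anti g => [H (Groupoid.inv g)]
  | antiInv g => [H (Groupoid.inv g)]
  | coint _ => []
  | integ g => [H g]
  | rib g => [H g]
  | ribInv g => [H g]

/-- Relabelling of an elementary morphism along a functor of groupoids:
`m_{g,h} ↦ m_{φ(g),φ(h)}`, `η_i ↦ η_{φ(i)}`, and so on. -/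
def Gen.map (φ : G ⥤ G') : Gen G → Gen G'
  | mul g h => mul (φ.map g) (φ.map h)
  | unit i => unit (φ.obj i)
  | comul g => comul (φ.map g)
  | counit g => counit (φ.map g)
  | anti g => anti (φ.map g)
  | antiInv g => antiInv (φ.map g)
  | coint i => coint (φ.obj i)
  | integ g => integ (φ.map g)
  | rib g => rib (φ.map g)
  | ribInv g => ribInv (φ.map g)

/-- Formal composites and products of identities, braidings and elementary morphisms. Objects are
sequences of labels, and the product of objects is concatenation. -/
inductive Term (G : Type u) [Groupoid.{v} G] : Type (max u v)
  /-- the identity of `A` -/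
  | id (A : List (Lab G)) : Term G
  /-- an elementary morphism -/
  | gen (e : Gen G) : Term G
  /-- `comp t s` is the composite `t ∘ s` (first `s`, then `t`) -/
  | comp (t s : Term G) : Term G
  /-- the product `t ⋄ s` -/
  | tensor (t s : Term G) : Term G
  /-- the braiding `γ_{A,B} : A ⋄ B → B ⋄ A` -/
  | braid (A B : List (Lab G)) : Term G
  /-- the inverse `B ⋄ A → A ⋄ B` of the braiding `γ_{A,B}` -/
  | braidInv (A B : List (Lab G)) : Term G

infixr:80 " ∘ₜ " => Term.comp
infixr:85 " ⋄ₜ " => Term.tensor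

namespace Term

/-- Source of a term. -/
def dom : Term G → List (Lab G)
  | id A => A
  | gen e => e.dom
  | comp _ s => s.dom
  | tensor t s => t.dom ++ s.dom
  | braid A B => A ++ B
  | braidInv A B => B ++ A

/-- Target of a term. -/
def cod : Term G → List (Lab G)
  | id A => A
  | gen e => e.cod
  | comp t _ => t.cod
  | tensor t s => t.cod ++ s.cod
  | braid A B => B ++ A
  | braidInv A B => A ++ B

/-- A term is well formed if every composite `t ∘ s` in it has matching target and source. -/
def WF : Term G → Prop
  | id _ => True
  | gen _ => True
  | comp t s => t.WF ∧ s.WF ∧ t.dom = s.cod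
  | tensor t s => t.WF ∧ s.WF
  | braid _ _ => True
  | braidInv _ _ => True

/-! The terms out of which the axioms are built. -/

/-- `id_g` -/
def idg {i j : G} (g : i ⟶ j) : Term G := id [H g]
/-- `m_{g,h}` -/
def m {i j k : G} (g : i ⟶ j) (h : j ⟶ k) : Term G := gen (.mul g h)
/-- `η_i` -/
def η (i : G) : Term G := gen (.unit i)
/-- `Δ_g` -/
def Δ {i j : G} (g : i ⟶ j) : Term G := gen (.comul g)
/-- `ε_g` -/
def ε {i j : G} (g : i ⟶ j) : Term G := gen (.counit g)
/-- `S_g` -/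
def S {i j : G} (g : i ⟶ j) : Term G := gen (.anti g)
/-- the inverse antipode `H_g → H_{g⁻¹}` -/
def Sbar {i j : G} (g : i ⟶ j) : Term G := gen (.antiInv g)
/-- `l_i` -/
def l (i : G) : Term G := gen (.coint i)
/-- `L_g` -/
def L {i j : G} (g : i ⟶ j) : Term G := gen (.integ g)
/-- `v_g` -/
def v {i j : G} (g : i ⟶ j) : Term G := gen (.rib g)
/-- `v_g⁻¹` -/
def vInv {i j : G} (g : i ⟶ j) : Term G := gen (.ribInv g)
/-- the braiding `γ_{g,h} : H_g ⋄ H_h → H_h ⋄ H_g` -/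
def γ {i j k l : G} (g : i ⟶ j) (h : k ⟶ l) : Term G := braid [H g] [H h]
/-- the opposite crossing `H_g ⋄ H_h → H_h ⋄ H_g`, which is the inverse of `γ_{h,g}` -/
def γbar {i j k l : G} (g : i ⟶ j) (h : k ⟶ l) : Term G := braidInv [H h] [H g]

open Classical in
/-- The copairing `σ_{i,j} : 1 → H_{1_i} ⋄ H_{1_j}`. -/
noncomputable def σ (i j : G) : Term G :=
  if i = j then
    (vInv (𝟙 j) ⋄ₜ (vInv (𝟙 j) ∘ₜ S (𝟙 j))) ∘ₜ Δ (𝟙 j) ∘ₜ v (𝟙 j) ∘ₜ η j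
  else η i ⋄ₜ η j

/-- `ρ^r_{g,j} : H_g → H_g ⋄ H_{1_j}` -/
noncomputable def ρr {a b : G} (g : a ⟶ b) (j : G) : Term G :=
  (m g (𝟙 b) ⋄ₜ idg (𝟙 j)) ∘ₜ (idg g ⋄ₜ σ b j)

/-- `ρ^l_{h,i} : H_h → H_{1_i} ⋄ H_h` -/
noncomputable def ρl {a b : G} (h : a ⟶ b) (i : G) : Term G :=
  (idg (𝟙 i) ⋄ₜ m (𝟙 a) h) ∘ₜ (σ i a ⋄ₜ idg h)

/-- `μ_{g,h} : H_g ⋄ H_h → H_g ⋄ H_h` -/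
noncomputable def μ {a b c d : G} (g : a ⟶ b) (h : c ⟶ d) : Term G :=
  (m g (𝟙 b) ⋄ₜ m (𝟙 c) h) ∘ₜ (idg g ⋄ₜ σ b c ⋄ₜ idg h)

end Term

open Term

/-- The axioms of a ribbon Hopf `G`-algebra. -/
inductive Ax : Term G → Term G → Prop
  -- coalgebra
  | a1 {i j : G} (g : i ⟶ j) : Ax ((Δ g ⋄ₜ idg g) ∘ₜ Δ g) ((idg g ⋄ₜ Δ g) ∘ₜ Δ g)
  | a2 {i j : G} (g : i ⟶ j) : Ax ((ε g ⋄ₜ idg g) ∘ₜ Δ g) (idg g)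
  | a2' {i j : G} (g : i ⟶ j) : Ax ((idg g ⋄ₜ ε g) ∘ₜ Δ g) (idg g)
  -- multiplication
  | a3 {i j k n : G} (f : i ⟶ j) (g : j ⟶ k) (h : k ⟶ n) :
      Ax (m (f ≫ g) h ∘ₜ (m f g ⋄ₜ idg h)) (m f (g ≫ h) ∘ₜ (idg f ⋄ₜ m g h))
  | a5 {i j k : G} (g : i ⟶ j) (h : j ⟶ k) :
      Ax ((m g h ⋄ₜ m g h) ∘ₜ (idg g ⋄ₜ γ g h ⋄ₜ idg h) ∘ₜ (Δ g ⋄ₜ Δ h)) (Δ (g ≫ h) ∘ₜ m g h)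
  | a6 {i j k : G} (g : i ⟶ j) (h : j ⟶ k) : Ax (ε (g ≫ h) ∘ₜ m g h) (ε g ⋄ₜ ε h)
  -- unit
  | a4 {i j : G} (g : i ⟶ j) : Ax (m g (𝟙 j) ∘ₜ (idg g ⋄ₜ η j)) (idg g)
  | a4' {i j : G} (g : i ⟶ j) : Ax (m (𝟙 i) g ∘ₜ (η i ⋄ₜ idg g)) (idg g)
  | a7 (i : G) : Ax (Δ (𝟙 i) ∘ₜ η i) (η i ⋄ₜ η i)
  | a8 (i : G) : Ax (ε (𝟙 i) ∘ₜ η i) (Term.id [])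
  -- antipode
  | s1 {i j : G} (g : i ⟶ j) :
      Ax (m (Groupoid.inv g) g ∘ₜ (S g ⋄ₜ idg g) ∘ₜ Δ g) (η j ∘ₜ ε g)
  | s1' {i j : G} (g : i ⟶ j) :
      Ax (m g (Groupoid.inv g) ∘ₜ (idg g ⋄ₜ S g) ∘ₜ Δ g) (η i ∘ₜ ε g)
  | s2 {i j : G} (g : i ⟶ j) : Ax (S (Groupoid.inv g) ∘ₜ Sbar g) (idg g)
  | s2' {i j : G} (g : i ⟶ j) : Ax (Sbar (Groupoid.inv g) ∘ₜ S g) (idg g)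
  -- two-sided cointegral and integral
  | i1 (i : G) : Ax ((idg (𝟙 i) ⋄ₜ l i) ∘ₜ Δ (𝟙 i)) (η i ∘ₜ l i)
  | i1' (i : G) : Ax ((l i ⋄ₜ idg (𝟙 i)) ∘ₜ Δ (𝟙 i)) (η i ∘ₜ l i)
  | i2 {i j k : G} (g : i ⟶ j) (h : j ⟶ k) : Ax (m g h ∘ₜ (L g ⋄ₜ idg h)) (L (g ≫ h) ∘ₜ ε h)
  | i2' {i j k : G} (g : i ⟶ j) (h : j ⟶ k) : Ax (m g h ∘ₜ (idg g ⋄ₜ L h)) (L (g ≫ h) ∘ₜ ε g)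
  | i3 (i : G) : Ax (l i ∘ₜ L (𝟙 i)) (Term.id [])
  | i3' (i : G) : Ax (l i ∘ₜ S (𝟙 i) ∘ₜ L (𝟙 i)) (Term.id [])
  -- unimodularity
  | i4 {i j : G} (g : i ⟶ j) : Ax (S g ∘ₜ L g) (L (Groupoid.inv g))
  | i5 (i : G) : Ax (l i ∘ₜ S (𝟙 i)) (l i)
  -- ribbon morphisms
  | r1 {i j : G} (g : i ⟶ j) : Ax (v g ∘ₜ vInv g) (idg g)
  | r1' {i j : G} (g : i ⟶ j) : Ax (vInv g ∘ₜ v g) (idg g)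
  | r2 {i j : G} (g : i ⟶ j) : Ax (ε g ∘ₜ v g) (ε g)
  | r3 {i j : G} (g : i ⟶ j) : Ax (v g ∘ₜ L g) (L g)
  | r4 {i j : G} (g : i ⟶ j) : Ax (S g ∘ₜ v g) (v (Groupoid.inv g) ∘ₜ S g)
  | r5 {i j k : G} (g : i ⟶ j) (h : j ⟶ k) :
      Ax (m g h ∘ₜ (v g ⋄ₜ idg h)) (v (g ≫ h) ∘ₜ m g h)
  | r5' {i j k : G} (g : i ⟶ j) (h : j ⟶ k) :
      Ax (v (g ≫ h) ∘ₜ m g h) (m g h ∘ₜ (idg g ⋄ₜ v h))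
  -- `σ_{i,j}` is a Hopf copairing
  | r8 (i j : G) :
      Ax ((Δ (𝟙 i) ⋄ₜ idg (𝟙 j)) ∘ₜ σ i j)
        ((idg (𝟙 i) ⋄ₜ idg (𝟙 i) ⋄ₜ m (𝟙 j) (𝟙 j)) ∘ₜ
          (idg (𝟙 i) ⋄ₜ σ i j ⋄ₜ idg (𝟙 j)) ∘ₜ σ i j)
  | r8' (i j : G) :
      Ax ((idg (𝟙 i) ⋄ₜ Δ (𝟙 j)) ∘ₜ σ i j)
        ((m (𝟙 i) (𝟙 i) ⋄ₜ idg (𝟙 j) ⋄ₜ idg (𝟙 j)) ∘ₜ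
          (idg (𝟙 i) ⋄ₜ σ i j ⋄ₜ idg (𝟙 j)) ∘ₜ σ i j)
  | r9 (i j : G) : Ax ((ε (𝟙 i) ⋄ₜ idg (𝟙 j)) ∘ₜ σ i j) (η j)
  | r9' (i j : G) : Ax ((idg (𝟙 i) ⋄ₜ ε (𝟙 j)) ∘ₜ σ i j) (η i)
  -- the ribbon morphism and the copairing
  | r10 {i j : G} (g : i ⟶ j) :
      Ax (Δ g ∘ₜ vInv g) (μ g g ∘ₜ (vInv g ⋄ₜ vInv g) ∘ₜ γbar g g ∘ₜ Δ g)
  -- the braiding and the copairing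
  | r11 {a i j b : G} (g : a ⟶ i) (h : j ⟶ b) :
      Ax ((m (𝟙 j) h ⋄ₜ m g (𝟙 i)) ∘ₜ
          (S (𝟙 j) ⋄ₜ (μ h g ∘ₜ γbar g h ∘ₜ μ g h) ⋄ₜ S (𝟙 i)) ∘ₜ (ρl g j ⋄ₜ ρr h i))
        (γ g h)

/-- Equality of morphisms in the universal ribbon Hopf `G`-algebra: the least congruence that
contains the axioms of a ribbon Hopf `G`-algebra and those of a strict braided monoidal category. -/
inductive Rel : Term G → Term G → Prop
  | ax {t s : Term G} : Ax t s → Rel t s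
  | refl (t : Term G) : Rel t t
  | symm {t s : Term G} : Rel t s → Rel s t
  | trans {t s r : Term G} : Rel t s → Rel s r → Rel t r
  | comp_congr {t t' s s' : Term G} : Rel t t' → Rel s s' → Rel (t ∘ₜ s) (t' ∘ₜ s')
  | tensor_congr {t t' s s' : Term G} : Rel t t' → Rel s s' → Rel (t ⋄ₜ s) (t' ⋄ₜ s')
  -- category
  | id_comp (t : Term G) : Rel (Term.id t.cod ∘ₜ t) t
  | comp_id (t : Term G) : Rel (t ∘ₜ Term.id t.dom) t
  | comp_assoc (t s r : Term G) : Rel ((t ∘ₜ s) ∘ₜ r) (t ∘ₜ s ∘ₜ r)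
  -- strict monoidal category
  | id_tensor_id (A B : List (Lab G)) : Rel (Term.id A ⋄ₜ Term.id B) (Term.id (A ++ B))
  | interchange (t t' s s' : Term G) (h : t.dom = t'.cod) (h' : s.dom = s'.cod) :
      Rel ((t ⋄ₜ s) ∘ₜ (t' ⋄ₜ s')) ((t ∘ₜ t') ⋄ₜ (s ∘ₜ s'))
  | tensor_assoc (t s r : Term G) : Rel ((t ⋄ₜ s) ⋄ₜ r) (t ⋄ₜ s ⋄ₜ r)
  | nil_tensor (t : Term G) : Rel (Term.id [] ⋄ₜ t) t
  | tensor_nil (t : Term G) : Rel (t ⋄ₜ Term.id []) t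
  -- braiding
  | braid_natural (t s : Term G) :
      Rel (braid t.cod s.cod ∘ₜ (t ⋄ₜ s)) ((s ⋄ₜ t) ∘ₜ braid t.dom s.dom)
  | braid_inv (A B : List (Lab G)) : Rel (braid A B ∘ₜ braidInv A B) (Term.id (B ++ A))
  | inv_braid (A B : List (Lab G)) : Rel (braidInv A B ∘ₜ braid A B) (Term.id (A ++ B))
  | hexagon (A B C : List (Lab G)) :
      Rel (braid A (B ++ C)) ((Term.id B ⋄ₜ braid A C) ∘ₜ (braid A B ⋄ₜ Term.id C))
  | hexagon' (A B C : List (Lab G)) :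
      Rel (braid (A ++ B) C) ((braid A C ⋄ₜ Term.id B) ∘ₜ (Term.id A ⋄ₜ braid B C))

/-! Well-formedness, source and target are invariant under the relations. -/

theorem H_inv_id (i : G) : H (Groupoid.inv (𝟙 i)) = H (𝟙 i) := by
  simp [Groupoid.inv_eq_inv]

theorem σ_typed (i j : G) :
    (σ i j).WF ∧ (σ i j).dom = [] ∧ (σ i j).cod = [H (𝟙 i), H (𝟙 j)] := by
  unfold σ
  split
  · subst_vars
    simp [vInv, S, Δ, v, η, WF, dom, cod, Gen.dom, Gen.cod]
  · simp [η, WF, dom, cod, Gen.dom, Gen.cod]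

theorem Ax.typed {t s : Term G} (h : Ax t s) :
    t.WF ∧ s.WF ∧ t.dom = s.dom ∧ t.cod = s.cod := by
  have hσ := fun i j : G => (σ_typed i j).1
  have hσd := fun i j : G => (σ_typed i j).2.1
  have hσc := fun i j : G => (σ_typed i j).2.2
  cases h <;>
    simp [idg, m, η, Δ, ε, S, Sbar, l, L, v, vInv, γ, γbar, μ, ρl, ρr, WF, dom, cod, Gen.dom,
      Gen.cod, hσ, hσd, hσc]

theorem Rel.typed {t s : Term G} (h : Rel t s) :
    (t.WF ↔ s.WF) ∧ t.dom = s.dom ∧ t.cod = s.cod := by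
  induction h with
  | ax h => obtain ⟨h1, h2, h3, h4⟩ := h.typed; exact ⟨⟨fun _ => h2, fun _ => h1⟩, h3, h4⟩
  | refl => simp
  | symm _ ih => exact ⟨ih.1.symm, ih.2.1.symm, ih.2.2.symm⟩
  | trans _ _ ih ih' => exact ⟨ih.1.trans ih'.1, ih.2.1.trans ih'.2.1, ih.2.2.trans ih'.2.2⟩
  | comp_congr _ _ ih ih' => simp [WF, dom, cod, ih, ih']
  | tensor_congr _ _ ih ih' => simp [WF, dom, cod, ih, ih']
  | interchange t t' s s' h h' => simp [WF, dom, cod, h, h']; tauto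
  | _ => simp [WF, dom, cod] <;> tauto

theorem Rel.id_comp_of {t : Term G} {A : List (Lab G)} (h : t.cod = A) :
    Rel (Term.id A ∘ₜ t) t := h ▸ Rel.id_comp t

theorem Rel.comp_id_of {t : Term G} {A : List (Lab G)} (h : t.dom = A) :
    Rel (t ∘ₜ Term.id A) t := h ▸ Rel.comp_id t

theorem Rel.id_of_eq {A B : List (Lab G)} (h : A = B) : Rel (Term.id A) (Term.id B) :=
  h ▸ Rel.refl _

theorem Rel.id_comp_id {t s : Term G} {A B : List (Lab G)} (ht : Rel t (Term.id A))
    (hs : Rel s (Term.id B)) (h : A = B) : Rel (t ∘ₜ s) (Term.id B) :=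
  (Rel.comp_congr ht hs).trans (Rel.id_comp_of h.symm)

theorem Rel.id_tensor {t s : Term G} {A B : List (Lab G)} (ht : Rel t (Term.id A))
    (hs : Rel s (Term.id B)) : Rel (t ⋄ₜ s) (Term.id (A ++ B)) :=
  (Rel.tensor_congr ht hs).trans (Rel.id_tensor_id A B)

/-- The universal ribbon Hopf `G`-algebra. Its objects are finite sequences of elements of `G`. -/
@[ext]
structure Hr (G : Type u) [Groupoid.{v} G] : Type (max u v) where
  labels : List (Lab G)

namespace Hr

/-- Well-formed terms with given source and target. -/
def Diagram (A B : Hr G) : Type (max u v) :=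
  {t : Term G // t.WF ∧ t.dom = A.labels ∧ t.cod = B.labels}

instance setoid (A B : Hr G) : Setoid (Diagram A B) where
  r t s := Rel t.1 s.1
  iseqv := ⟨fun t => .refl t.1, .symm, .trans⟩

/-- Morphisms `A → B`: well-formed terms modulo the relations. -/
def Mor (A B : Hr G) : Type (max u v) := Quotient (setoid A B)

/-- The morphism represented by a well-formed term. -/
def ofTerm {A B : Hr G} (t : Term G) (w : t.WF) (d : t.dom = A.labels) (c : t.cod = B.labels) :
    Mor A B := Quotient.mk _ ⟨t, w, d, c⟩

theorem ind {A B : Hr G} {p : Mor A B → Prop} (h : ∀ t w d c, p (ofTerm t w d c)) (f : Mor A B) :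
    p f := Quotient.ind (fun t => h t.1 t.2.1 t.2.2.1 t.2.2.2) f

/-- Composition: first `f`, then `g`. -/
def compMor {A B C : Hr G} (f : Mor A B) (g : Mor B C) : Mor A C :=
  Quotient.map₂ (fun (t : Diagram A B) (s : Diagram B C) =>
    (⟨s.1 ∘ₜ t.1, ⟨s.2.1, t.2.1, s.2.2.1.trans t.2.2.2.symm⟩, t.2.2.1, s.2.2.2⟩ : Diagram A C))
    (fun _ _ h _ _ h' => Rel.comp_congr h' h) f g

instance category : Category (Hr G) where
  Hom := Mor
  id A := ofTerm (Term.id A.labels) trivial rfl rfl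
  comp := compMor
  id_comp f := by
    induction f using ind with | h t w d c => ?_
    refine Quotient.sound ?_
    have := Rel.comp_id t
    rwa [d] at this
  comp_id f := by
    induction f using ind with | h t w d c => ?_
    refine Quotient.sound ?_
    have := Rel.id_comp t
    rwa [c] at this
  assoc f g h := by
    induction f using ind with | h t w d c => ?_
    induction g using ind with | h t w d c => ?_
    induction h using ind with | h t w d c => ?_
    exact Quotient.sound (Rel.comp_assoc _ _ _).symm

/-- Product of objects: concatenation of sequences. -/
def tensorObj (A B : Hr G) : Hr G := ⟨A.labels ++ B.labels⟩

/-- Product of morphisms. -/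
def tensorMor {A B C D : Hr G} (f : Mor A B) (g : Mor C D) :
    Mor (tensorObj A C) (tensorObj B D) :=
  Quotient.map₂ (fun (t : Diagram A B) (s : Diagram C D) =>
    (⟨t.1 ⋄ₜ s.1, ⟨t.2.1, s.2.1⟩, by simp [dom, tensorObj, t.2.2.1, s.2.2.1], by
      simp [cod, tensorObj, t.2.2.2, s.2.2.2]⟩ : Diagram (tensorObj A C) (tensorObj B D)))
    (fun _ _ h _ _ h' => Rel.tensor_congr h h') f g

/-- The identity morphism between equal objects, as an isomorphism. -/
def isoOfEq {A B : Hr G} (h : A.labels = B.labels) : A ≅ B where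
  hom := ofTerm (Term.id A.labels) trivial rfl h
  inv := ofTerm (Term.id A.labels) trivial h rfl
  hom_inv_id := Quotient.sound (Rel.id_comp (Term.id A.labels))
  inv_hom_id := Quotient.sound
    ((Rel.id_comp (Term.id A.labels)).trans (by rw [h]; exact Rel.refl _))

/-- The strict monoidal structure. -/
instance monoidalStruct : MonoidalCategoryStruct (Hr G) where
  tensorObj := tensorObj
  tensorHom := tensorMor
  whiskerLeft A _ _ f := tensorMor (𝟙 A) f
  whiskerRight f B := tensorMor f (𝟙 B)
  tensorUnit := ⟨[]⟩
  associator _ _ _ := isoOfEq (List.append_assoc _ _ _)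
  leftUnitor _ := isoOfEq rfl
  rightUnitor _ := isoOfEq (List.append_nil _)

theorem tensorObj_labels (A B : Hr G) : (tensorObj A B).labels = A.labels ++ B.labels := rfl

theorem tensor_labels (A B : Hr G) : (A ⊗ B).labels = A.labels ++ B.labels := rfl

theorem unit_labels : (𝟙_ (Hr G)).labels = [] := rfl

instance monoidal : MonoidalCategory (Hr G) := .ofTensorHom
  (id_tensorHom_id := fun _ _ => Quotient.sound (Rel.id_tensor_id _ _))
  (id_tensorHom := fun _ _ _ _ => rfl)
  (tensorHom_id := fun _ _ => rfl)
  (tensorHom_comp_tensorHom := fun f f' g g' => by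
    induction f using ind with | h t w d c => ?_
    induction f' using ind with | h t' w' d' c' => ?_
    induction g using ind with | h s x e b => ?_
    induction g' using ind with | h s' x' e' b' => ?_
    exact Quotient.sound (Rel.interchange _ _ _ _ (e.trans c.symm) (e'.trans c'.symm)))
  (associator_naturality := fun f g h => by
    induction f using ind with | h t w d c => ?_
    induction g using ind with | h t' w' d' c' => ?_
    induction h using ind with | h t'' w'' d'' c'' => ?_
    refine Quotient.sound (Rel.trans (Rel.id_comp_of ?_)
      ((Rel.tensor_assoc t t' t'').trans (Rel.comp_id_of ?_).symm))
    · change (t.cod ++ t'.cod) ++ t''.cod = _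
      rw [c, c', c'']; rfl
    · change t.dom ++ (t'.dom ++ t''.dom) = _
      rw [d, d', d'', ← List.append_assoc]; rfl)
  (leftUnitor_naturality := fun f => by
    induction f using ind with | h t w d c => ?_
    exact Quotient.sound (Rel.trans (Rel.id_comp_of c)
      ((Rel.nil_tensor t).trans (Rel.comp_id_of d).symm)))
  (rightUnitor_naturality := fun f => by
    induction f using ind with | h t w d c => ?_
    refine Quotient.sound (Rel.trans (Rel.id_comp_of ?_)
      ((Rel.tensor_nil t).trans (Rel.comp_id_of ?_).symm))
    · change t.cod ++ [] = _
      rw [c]; rfl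
    · rw [d]; exact (List.append_nil _).symm)
  (pentagon := fun A B C D => by
    refine Quotient.sound (Rel.trans (Rel.id_comp_id (Rel.id_comp_id (Rel.id_tensor (Rel.refl _)
      (Rel.refl _)) (Rel.refl _) ?_) (Rel.id_tensor (Rel.refl _) (Rel.refl _)) ?_)
      (Rel.id_comp_id (Rel.refl _) (Rel.refl _) ?_).symm)
    · simp [tensorObj_labels, tensor_labels, unit_labels, dom, cod]
    · simp [tensorObj_labels, tensor_labels, unit_labels, dom, cod]
    · simp [tensorObj_labels, tensor_labels, unit_labels, dom, cod])
  (triangle := fun A B => by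
    refine Quotient.sound (Rel.trans (Rel.id_comp_id (Rel.id_tensor (Rel.refl _) (Rel.refl _))
      (Rel.refl _) ?_) (Rel.trans (Rel.id_of_eq ?_)
      (Rel.id_tensor (Rel.refl _) (Rel.refl _)).symm))
    · simp [tensorObj_labels, tensor_labels, unit_labels, dom, cod]
    · simp [tensorObj_labels, tensor_labels, unit_labels, dom, cod])

/-- The braiding as an isomorphism. -/
def braidIso (A B : Hr G) : A ⊗ B ≅ B ⊗ A where
  hom := ofTerm (braid A.labels B.labels) trivial rfl rfl
  inv := ofTerm (braidInv A.labels B.labels) trivial rfl rfl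
  hom_inv_id := Quotient.sound (Rel.inv_braid _ _)
  inv_hom_id := Quotient.sound (Rel.braid_inv _ _)

theorem braid_nat {A B C D : Hr G} (f : A ⟶ B) (g : C ⟶ D) :
    (f ⊗ₘ g) ≫ (braidIso B D).hom = (braidIso A C).hom ≫ (g ⊗ₘ f) := by
  induction f using ind with | h t w d c => ?_
  induction g using ind with | h t' w' d' c' => ?_
  have := Rel.braid_natural t t'
  rw [c, c', d, d'] at this
  exact Quotient.sound this

instance braided : BraidedCategory (Hr G) where
  braiding A B := braidIso A B
  braiding_naturality_right A _ _ f := braid_nat (𝟙 A) f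
  braiding_naturality_left f A := braid_nat f (𝟙 A)
  hexagon_forward A B C := by
    refine Quotient.sound (Rel.trans (Rel.trans (Rel.comp_id_of ?_) (Rel.id_comp_of ?_))
      ((Rel.hexagon A.labels B.labels C.labels).trans
        (Rel.comp_congr (Rel.comp_id_of ?_) (Rel.refl _)).symm))
    · simp [tensorObj_labels, tensor_labels, unit_labels, dom, cod]
    · simp [tensorObj_labels, tensor_labels, unit_labels, dom, cod]
    · simp [tensorObj_labels, tensor_labels, unit_labels, dom, cod]
  hexagon_reverse A B C := by
    refine Quotient.sound (Rel.trans (Rel.trans (Rel.comp_id_of ?_) (Rel.id_comp_of ?_))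
      ((Rel.hexagon' A.labels B.labels C.labels).trans
        (Rel.comp_congr (Rel.comp_id_of ?_) (Rel.refl _)).symm))
    · simp [tensorObj_labels, tensor_labels, unit_labels, dom, cod]
    · simp [tensorObj_labels, tensor_labels, unit_labels, dom, cod]
    · simp [tensorObj_labels, tensor_labels, unit_labels, dom, cod]

/-- The morphism of the universal ribbon Hopf `G`-algebra given by an elementary morphism. -/
def ofGen (e : Gen G) : (⟨e.dom⟩ : Hr G) ⟶ ⟨e.cod⟩ := ofTerm (Term.gen e) trivial rfl rfl

/-- The action on objects of a functor of groupoids. -/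
def mapObj (φ : G ⥤ G') (A : Hr G) : Hr G' := ⟨A.labels.map (Lab.map φ)⟩

end Hr

/-- `Υ` extends `φ`: it sends `H_g` to `H_{φ(g)}`, each elementary morphism to the elementary
morphism with the labels changed by `φ`, and it strictly preserves products and braidings. -/
structure Extends (φ : G ⥤ G') (Υ : Hr G ⥤ Hr G') : Prop where
  obj (A : Hr G) : Υ.obj A = Hr.mapObj φ A
  map_gen (e : Gen G) : Υ.map (Hr.ofGen e) ≍ Hr.ofGen (e.map φ)
  map_tensor {A B C D : Hr G} (f : A ⟶ B) (g : C ⟶ D) : Υ.map (f ⊗ₘ g) ≍ Υ.map f ⊗ₘ Υ.map g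
  map_braiding (A B : Hr G) : Υ.map (β_ A B).hom ≍ (β_ (Υ.obj A) (Υ.obj B)).hom

end RibbonHopf

namespace RibbonHopf

variable {G : Type u} [Groupoid.{v} G] {G' : Type u'} [Groupoid.{v'} G']

open Term

/-! ### Relabelling terms along a functor -/

/-! `Υ` is relabelling of terms. The defining relations are preserved because `φ` commutes with
composites, identities and inverses; injectivity on objects is needed only because `σ i j` is
defined by cases on `i = j` (`map_σ`).

Faithfulness is the substantial claim: two relabelled terms may be related in `G'` through terms
with labels outside the image of `φ`. Call a morphism of `G'` admissible if it lies in the image of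
`φ` or joins two objects outside that image. Admissible morphisms contain all identities and are
closed under inverses and composition. Each relation has admissible labels on one side exactly when
it does on the other (`Rel.adm_iff`), so a derivation that starts at a relabelled term never leaves
the admissible terms.

On admissible terms relabelling is undone by `Term.back`: labels in the image go to their preimage,
unique when `φ` is also faithful, and all others are interpreted in the trivial Hopf algebra `1`. An
axiom with every label in the image pulls back to the same axiom for `G`, and one with none becomes
an identity of the unit object. Only axioms about `σ i j` can mix the two kinds; there `σ i j` is `η
i ⋄ₜ η j`, of which one factor survives, and the axiom reduces to unit laws and `S η = η`
(`Ax.back`). Hence `back` respects the relations (`Rel.back`), and `back_map` turns a relation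
between images into one between the original terms. -/

theorem Gen.map_dom (φ : G ⥤ G') (e : Gen G) : (e.map φ).dom = e.dom.map (Lab.map φ) := by
  cases e <;> simp [Gen.map, Gen.dom, Lab.map]

theorem Gen.map_cod (φ : G ⥤ G') (e : Gen G) : (e.map φ).cod = e.cod.map (Lab.map φ) := by
  cases e <;> simp [Gen.map, Gen.cod, Lab.map, Groupoid.inv_eq_inv]

namespace Term

/-- Relabelling of a term along a functor of groupoids. -/
def map (φ : G ⥤ G') : Term G → Term G'
  | id A => id (A.map (Lab.map φ))
  | gen e => gen (e.map φ)
  | comp t s => comp (t.map φ) (s.map φ)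
  | tensor t s => tensor (t.map φ) (s.map φ)
  | braid A B => braid (A.map (Lab.map φ)) (B.map (Lab.map φ))
  | braidInv A B => braidInv (A.map (Lab.map φ)) (B.map (Lab.map φ))

theorem map_dom (φ : G ⥤ G') (t : Term G) : (t.map φ).dom = t.dom.map (Lab.map φ) := by
  induction t <;> simp_all [map, dom, Gen.map_dom]

theorem map_cod (φ : G ⥤ G') (t : Term G) : (t.map φ).cod = t.cod.map (Lab.map φ) := by
  induction t <;> simp_all [map, cod, Gen.map_cod]

theorem WF.map (φ : G ⥤ G') {t : Term G} (h : t.WF) : (t.map φ).WF := by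
  induction t with
  | comp t s iht ihs => exact ⟨iht h.1, ihs h.2.1, by rw [map_dom, map_cod, h.2.2]⟩
  | tensor t s iht ihs => exact ⟨iht h.1, ihs h.2⟩
  | _ => trivial

/-- Without injectivity, distinct `i`, `j` with equal images would turn the trivial copairing into
the nontrivial one. -/
theorem map_σ (φ : G ⥤ G') (hφ : Function.Injective φ.obj) (i j : G) :
    (σ i j).map φ = σ (φ.obj i) (φ.obj j) := by
  by_cases h : i = j
  · subst h
    simp [σ, map, vInv, S, Δ, v, η, Gen.map]
  · simp [σ, h, hφ.ne h, map, η, Gen.map]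

end Term

theorem Ax.map (φ : G ⥤ G') (hφ : Function.Injective φ.obj) {t s : Term G} (h : Ax t s) :
    Ax (t.map φ) (s.map φ) := by
  have hσ := map_σ φ hφ
  have hinv {i j : G} (g : i ⟶ j) : φ.map (Groupoid.inv g) = Groupoid.inv (φ.map g) := by
    simp [Groupoid.inv_eq_inv]
  cases h <;>
    simp only [idg, m, η, Δ, ε, S, Sbar, l, L, v, vInv, γ, γbar, μ, ρl, ρr, Term.map, Gen.map, hσ,
      List.map, Lab.map, φ.map_id, φ.map_comp, hinv]
  case a1 => exact .a1 _
  case a2 => exact .a2 _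
  case a2' => exact .a2' _
  case a3 => exact .a3 _ _ _
  case a5 => exact .a5 _ _
  case a6 => exact .a6 _ _
  case a4 => exact .a4 _
  case a4' => exact .a4' _
  case a7 => exact .a7 _
  case a8 => exact .a8 _
  case s1 => exact .s1 _
  case s1' => exact .s1' _
  case s2 => exact .s2 _
  case s2' => exact .s2' _
  case i1 => exact .i1 _
  case i1' => exact .i1' _
  case i2 => exact .i2 _ _
  case i2' => exact .i2' _ _
  case i3 => exact .i3 _
  case i3' => exact .i3' _
  case i4 => exact .i4 _
  case i5 => exact .i5 _
  case r1 => exact .r1 _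
  case r1' => exact .r1' _
  case r2 => exact .r2 _
  case r3 => exact .r3 _
  case r4 => exact .r4 _
  case r5 => exact .r5 _ _
  case r5' => exact .r5' _ _
  case r8 => exact .r8 _ _
  case r8' => exact .r8' _ _
  case r9 => exact .r9 _ _
  case r9' => exact .r9' _ _
  case r10 => exact .r10 _
  case r11 => exact .r11 _ _

theorem Rel.map (φ : G ⥤ G') (hφ : Function.Injective φ.obj) {t s : Term G} (h : Rel t s) :
    Rel (t.map φ) (s.map φ) := by
  induction h with
  | ax h => exact .ax (h.map φ hφ)
  | refl => exact .refl _
  | symm _ ih => exact ih.symm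
  | trans _ _ ih ih' => exact ih.trans ih'
  | comp_congr _ _ ih ih' => exact .comp_congr ih ih'
  | tensor_congr _ _ ih ih' => exact .tensor_congr ih ih'
  | id_comp t => exact .id_comp_of (map_cod φ t)
  | comp_id t => exact .comp_id_of (map_dom φ t)
  | comp_assoc t s r => exact .comp_assoc _ _ _
  | id_tensor_id A B => simpa [Term.map] using Rel.id_tensor_id _ _
  | interchange t t' s s' h h' =>
    exact .interchange _ _ _ _ (by rw [map_dom, map_cod, h]) (by rw [map_dom, map_cod, h'])
  | tensor_assoc t s r => exact .tensor_assoc _ _ _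
  | nil_tensor t => exact .nil_tensor _
  | tensor_nil t => exact .tensor_nil _
  | braid_natural t s =>
    simpa only [Term.map, map_dom, map_cod] using Rel.braid_natural (t.map φ) (s.map φ)
  | braid_inv A B => simpa [Term.map] using Rel.braid_inv _ _
  | inv_braid A B => simpa [Term.map] using Rel.inv_braid _ _
  | hexagon A B C => simpa [Term.map] using Rel.hexagon _ _ _
  | hexagon' A B C => simpa [Term.map] using Rel.hexagon' _ _ _

/-! ### The induced functor -/

namespace Hr

/-- The action on morphisms of a functor of groupoids that is injective on objects. -/
def mapMor (φ : G ⥤ G') (hφ : Function.Injective φ.obj) {A B : Hr G} (f : Mor A B) :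
    Mor (mapObj φ A) (mapObj φ B) :=
  Quotient.map (fun t : Diagram A B =>
    (⟨t.1.map φ, t.2.1.map φ, by rw [map_dom, t.2.2.1, mapObj],
      by rw [map_cod, t.2.2.2, mapObj]⟩ : Diagram (mapObj φ A) (mapObj φ B)))
    (fun _ _ h => Rel.map φ hφ h) f

/-- The functor between universal ribbon Hopf algebras induced by a functor of groupoids that is
injective on objects. -/
def mapFunctor (φ : G ⥤ G') (hφ : Function.Injective φ.obj) : Hr G ⥤ Hr G' where
  obj := mapObj φ
  map := mapMor φ hφ
  map_id _ := rfl
  map_comp f g := by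
    induction f using ind with | h t w d c => ?_
    induction g using ind with | h t w d c => ?_
    rfl

/-- Strict preservation holds only up to propositional equality of objects; this reduces the
resulting heterogeneous equalities to equality of representing terms. -/
theorem mk_heq {A A' B B' : Hr G} (hA : A = A') (hB : B = B') {t : Diagram A B}
    {t' : Diagram A' B'} (ht : t.1 = t'.1) :
    (Quotient.mk (setoid A B) t : Mor A B) ≍ (Quotient.mk (setoid A' B') t' : Mor A' B') := by
  subst hA hB
  rw [Subtype.ext ht]

theorem mapObj_tensor (φ : G ⥤ G') (A B : Hr G) :
    mapObj φ (A ⊗ B) = mapObj φ A ⊗ mapObj φ B :=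
  Hr.ext (List.map_append)

theorem mapFunctor_extends (φ : G ⥤ G') (hφ : Function.Injective φ.obj) :
    Extends φ (mapFunctor φ hφ) where
  obj _ := rfl
  map_gen e := mk_heq (Hr.ext (e.map_dom φ).symm) (Hr.ext (e.map_cod φ).symm) rfl
  map_tensor f g := by
    induction f using ind with | h t w d c => ?_
    induction g using ind with | h s x e b => ?_
    exact mk_heq (mapObj_tensor φ _ _) (mapObj_tensor φ _ _)
      (t := ⟨Term.map φ (t ⋄ₜ s), _⟩) (t' := ⟨t.map φ ⋄ₜ s.map φ, _⟩) rfl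
  map_braiding A B := mk_heq (mapObj_tensor _ _ _) (mapObj_tensor _ _ _) rfl

end Hr

/-! ### The wide subgroupoid of admissible labels -/

/-- A morphism of `G'` is admissible for `φ` if it is in the image of `φ` or runs between objects
outside the image of `φ`. -/
inductive Adm (φ : G ⥤ G') : ∀ {i j : G'}, (i ⟶ j) → Prop
  | img {a b : G} (g : a ⟶ b) : Adm φ (φ.map g)
  | out {i j : G'} (hi : i ∉ Set.range φ.obj) (hj : j ∉ Set.range φ.obj) (g : i ⟶ j) : Adm φ g

namespace Adm

variable {φ : G ⥤ G'}

/-- Injectivity on objects allows the preimage to start at the prescribed `a`, so that preimages of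
composable morphisms are again composable. -/
theorem of_src (hφ : Function.Injective φ.obj) {a : G} {i k : G'} (hi : φ.obj a = i)
    {h : i ⟶ k} (H : Adm φ h) : ∃ (b : G) (h₀ : a ⟶ b), k = φ.obj b ∧ h ≍ φ.map h₀ := by
  cases H with
  | @img a' b g =>
    cases hφ hi
    exact ⟨b, g, rfl, HEq.rfl⟩
  | out hi' _ _ => exact absurd ⟨a, hi⟩ hi'

theorem tgt_of_src_notMem {i j : G'} {g : i ⟶ j} (H : Adm φ g) (hi : i ∉ Set.range φ.obj) :
    j ∉ Set.range φ.obj := by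
  cases H with
  | img g => exact absurd ⟨_, rfl⟩ hi
  | out _ hj _ => exact hj

theorem id (φ : G ⥤ G') (i : G') : Adm φ (𝟙 i) := by
  by_cases h : i ∈ Set.range φ.obj
  · obtain ⟨a, rfl⟩ := h
    rw [← φ.map_id]
    exact img _
  · exact out h h _

theorem inv {i j : G'} {g : i ⟶ j} (H : Adm φ g) : Adm φ (Groupoid.inv g) := by
  cases H with
  | img g =>
    have : Groupoid.inv (φ.map g) = φ.map (Groupoid.inv g) := by simp [Groupoid.inv_eq_inv]
    rw [this]
    exact img _
  | out hi hj _ => exact out hj hi _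

theorem inv_iff {i j : G'} {g : i ⟶ j} : Adm φ (Groupoid.inv g) ↔ Adm φ g :=
  ⟨fun H => by simpa [Groupoid.inv_eq_inv] using H.inv, inv⟩

theorem comp (hφ : Function.Injective φ.obj) {i j k : G'} {g : i ⟶ j} {h : j ⟶ k}
    (hg : Adm φ g) (hh : Adm φ h) : Adm φ (g ≫ h) := by
  cases hg with
  | img g =>
    obtain ⟨b, h₀, rfl, e⟩ := hh.of_src hφ rfl
    cases e
    rw [← φ.map_comp]
    exact img _
  | out hi hj _ => exact out hi (hh.tgt_of_src_notMem hj) _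

/-- Cancellation by the inverse recovers a label that one side of an axiom does not show, as `g` in
`i2`. -/
theorem comp_iff_left (hφ : Function.Injective φ.obj) {i j k : G'} {g : i ⟶ j} {h : j ⟶ k}
    (hh : Adm φ h) : Adm φ (g ≫ h) ↔ Adm φ g :=
  ⟨fun H => by simpa [Groupoid.inv_eq_inv] using H.comp hφ hh.inv, fun H => H.comp hφ hh⟩

theorem comp_iff_right (hφ : Function.Injective φ.obj) {i j k : G'} {g : i ⟶ j} {h : j ⟶ k}
    (hg : Adm φ g) : Adm φ (g ≫ h) ↔ Adm φ h :=
  ⟨fun H => by simpa [Groupoid.inv_eq_inv] using hg.inv.comp hφ H, fun H => hg.comp hφ H⟩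

end Adm

/-- All labels of a sequence are admissible. -/
def LabelsAdm (φ : G ⥤ G') (A : List (Lab G')) : Prop := ∀ a ∈ A, Adm φ a.hom

theorem labelsAdm_nil (φ : G ⥤ G') : LabelsAdm φ [] := by simp [LabelsAdm]

theorem labelsAdm_cons (φ : G ⥤ G') (a : Lab G') (A : List (Lab G')) :
    LabelsAdm φ (a :: A) ↔ Adm φ a.hom ∧ LabelsAdm φ A := by simp [LabelsAdm]

theorem labelsAdm_append (φ : G ⥤ G') (A B : List (Lab G')) :
    LabelsAdm φ (A ++ B) ↔ LabelsAdm φ A ∧ LabelsAdm φ B := by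
  simp [LabelsAdm, or_imp, forall_and]

theorem labelsAdm_map (φ : G ⥤ G') (A : List (Lab G)) : LabelsAdm φ (A.map (Lab.map φ)) := by
  intro a ha
  obtain ⟨b, -, rfl⟩ := List.mem_map.1 ha
  exact .img b.hom

/-- All labels that occur in a term are admissible. -/
def Term.Adm (φ : G ⥤ G') : Term G' → Prop
  | id A => LabelsAdm φ A
  | gen e => LabelsAdm φ e.dom ∧ LabelsAdm φ e.cod
  | comp t s => t.Adm φ ∧ s.Adm φ
  | tensor t s => t.Adm φ ∧ s.Adm φ
  | braid A B => LabelsAdm φ A ∧ LabelsAdm φ B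
  | braidInv A B => LabelsAdm φ A ∧ LabelsAdm φ B

theorem Term.Adm.dom_cod {φ : G ⥤ G'} {t : Term G'} (h : t.Adm φ) :
    LabelsAdm φ t.dom ∧ LabelsAdm φ t.cod := by
  induction t with
  | comp t s iht ihs => exact ⟨(ihs h.2).1, (iht h.1).2⟩
  | tensor t s iht ihs =>
    simp only [dom, cod, labelsAdm_append]
    exact ⟨⟨(iht h.1).1, (ihs h.2).1⟩, (iht h.1).2, (ihs h.2).2⟩
  | id A => exact ⟨h, h⟩
  | gen e => exact h
  | braid A B =>
    simp only [dom, cod, labelsAdm_append]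
    exact ⟨h, h.symm⟩
  | braidInv A B =>
    simp only [dom, cod, labelsAdm_append]
    exact ⟨h.symm, h⟩

theorem Term.adm_map (φ : G ⥤ G') (t : Term G) : (t.map φ).Adm φ := by
  induction t with
  | gen e =>
    simp only [Term.map, Term.Adm, Gen.map_dom, Gen.map_cod]
    exact ⟨labelsAdm_map φ _, labelsAdm_map φ _⟩
  | _ => simp_all [Term.map, Term.Adm, labelsAdm_map]

theorem Term.adm_σ (φ : G ⥤ G') (i j : G') : (σ i j).Adm φ := by
  unfold σ
  split <;> simp [vInv, S, Δ, v, η, Term.Adm, Gen.dom, Gen.cod, labelsAdm_nil, labelsAdm_cons,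
    Adm.inv_iff, Adm.id]

/-- The labels on either side of an axiom generate those on the other under composition, inversion
and adjoining identities. Identities of all objects have to be admissible, since `a8` read backwards
creates them from nothing. -/
theorem Ax.adm_iff {φ : G ⥤ G'} (hφ : Function.Injective φ.obj) {t s : Term G'} (h : Ax t s) :
    t.Adm φ ↔ s.Adm φ := by
  have h1 {i j k : G'} (g : i ⟶ j) (h : j ⟶ k) : Adm φ g → Adm φ h → Adm φ (g ≫ h) :=
    fun hg hh => hg.comp hφ hh
  have h2 {i j k : G'} (g : i ⟶ j) (h : j ⟶ k) : Adm φ h → Adm φ (g ≫ h) → Adm φ g :=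
    fun hh => (Adm.comp_iff_left hφ hh).1
  have h3 {i j k : G'} (g : i ⟶ j) (h : j ⟶ k) : Adm φ g → Adm φ (g ≫ h) → Adm φ h :=
    fun hg => (Adm.comp_iff_right hφ hg).1
  cases h <;>
    simp [-Groupoid.inv_eq_inv, idg, m, η, Δ, ε, S, Sbar, l, L, v, vInv, γ, γbar, μ, ρl, ρr,
      Term.Adm, Gen.dom, Gen.cod, labelsAdm_nil, labelsAdm_cons, Adm.inv_iff, Adm.id, adm_σ]
  case a3 f g h => have := h1 f g; have := h1 g h; tauto
  case a5 g h => tauto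
  case a6 g h => have := h1 g h; tauto
  case s1 g => exact fun hg => ⟨hg, h1 _ _ hg.inv hg⟩
  case s1' g => exact fun hg => ⟨hg, h1 _ _ hg hg.inv⟩
  case i2 g h => have := h1 g h; have := h2 g h; tauto
  case i2' g h => have := h1 g h; have := h3 g h; tauto
  all_goals tauto

theorem Rel.adm_iff {φ : G ⥤ G'} (hφ : Function.Injective φ.obj) {t s : Term G'} (h : Rel t s) :
    t.Adm φ ↔ s.Adm φ := by
  induction h with
  | ax h => exact h.adm_iff hφ
  | refl => rfl
  | symm _ ih => exact ih.symm
  | trans _ _ ih ih' => exact ih.trans ih'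
  | comp_congr _ _ ih ih' => exact and_congr ih ih'
  | tensor_congr _ _ ih ih' => exact and_congr ih ih'
  | id_comp t => exact ⟨fun h => h.2, fun h => ⟨h.dom_cod.2, h⟩⟩
  | comp_id t => exact ⟨fun h => h.1, fun h => ⟨h, h.dom_cod.1⟩⟩
  | braid_natural t s =>
    exact ⟨fun h => ⟨h.2.symm, h.2.1.dom_cod.1, h.2.2.dom_cod.1⟩,
      fun h => ⟨⟨h.1.2.dom_cod.2, h.1.1.dom_cod.2⟩, h.1.symm⟩⟩
  | nil_tensor t => simp [Term.Adm, labelsAdm_nil]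
  | tensor_nil t => simp [Term.Adm, labelsAdm_nil]
  | comp_assoc => exact and_assoc
  | tensor_assoc => exact and_assoc
  | _ => simp only [Term.Adm, labelsAdm_append]; try tauto

/-! ### Calculus of terms up to the relations -/

instance Term.setoid (G : Type u) [Groupoid.{v} G] : Setoid (Term G) where
  r := Rel
  iseqv := ⟨.refl, .symm, .trans⟩

/-- Terms modulo the relations. -/
def TermClass (G : Type u) [Groupoid.{v} G] : Type (max u v) := Quotient (Term.setoid G)

namespace TermClass

/-- The class of a term. -/
def mk (t : Term G) : TermClass G := Quotient.mk _ t

/-- Composition of classes. -/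
def comp : TermClass G → TermClass G → TermClass G :=
  Quotient.map₂ Term.comp fun _ _ h _ _ h' => Rel.comp_congr h h'

/-- Product of classes. -/
def tensor : TermClass G → TermClass G → TermClass G :=
  Quotient.map₂ Term.tensor fun _ _ h _ _ h' => Rel.tensor_congr h h'

theorem sound {t s : Term G} (h : Rel t s) : mk t = mk s := Quotient.sound h

theorem exact {t s : Term G} (h : mk t = mk s) : Rel t s := Quotient.exact h

theorem mk_comp (t s : Term G) : mk (t ∘ₜ s) = comp (mk t) (mk s) := rfl

theorem mk_tensor (t s : Term G) : mk (t ⋄ₜ s) = tensor (mk t) (mk s) := rfl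

theorem comp_assoc (x y z : TermClass G) : comp (comp x y) z = comp x (comp y z) := by
  induction x using Quotient.ind
  induction y using Quotient.ind
  induction z using Quotient.ind
  exact sound (.comp_assoc _ _ _)

theorem nil_tensor (x : TermClass G) : tensor (mk (Term.id [])) x = x := by
  induction x using Quotient.ind
  exact sound (.nil_tensor _)

theorem tensor_nil (x : TermClass G) : tensor x (mk (Term.id [])) = x := by
  induction x using Quotient.ind
  exact sound (.tensor_nil _)

theorem id_comp {t : Term G} {A : List (Lab G)} (h : t.cod = A) :
    comp (mk (Term.id A)) (mk t) = mk t := sound (.id_comp_of h)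

theorem comp_id {t : Term G} {A : List (Lab G)} (h : t.dom = A) :
    comp (mk t) (mk (Term.id A)) = mk t := sound (.comp_id_of h)

theorem id_comp_id (A : List (Lab G)) :
    comp (mk (Term.id A)) (mk (Term.id A)) = mk (Term.id A) := id_comp rfl

/-- The hexagon with two empty sequences makes this braiding idempotent; being invertible, it is the
identity. -/
theorem braid_nil (A : List (Lab G)) : mk (braid A []) = mk (Term.id A) := by
  have h : mk (braid A []) = comp (mk (braid A [])) (mk (braid A [])) := by
    simpa [mk_comp, mk_tensor, nil_tensor, tensor_nil] using sound (Rel.hexagon A [] [])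
  have h' : comp (mk (braidInv A [])) (mk (braid A [])) = mk (Term.id A) := by
    simpa [mk_comp] using sound (Rel.inv_braid A [])
  have := congrArg (comp (mk (braidInv A []))) h
  rw [← comp_assoc, h', id_comp (by simp [cod])] at this
  exact this.symm

theorem nil_braid (A : List (Lab G)) : mk (braid [] A) = mk (Term.id A) := by
  have h : mk (braid [] A) = comp (mk (braid [] A)) (mk (braid [] A)) := by
    simpa [mk_comp, mk_tensor, nil_tensor, tensor_nil] using sound (Rel.hexagon' [] [] A)
  have h' : comp (mk (braidInv [] A)) (mk (braid [] A)) = mk (Term.id A) := by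
    simpa [mk_comp] using sound (Rel.inv_braid [] A)
  have := congrArg (comp (mk (braidInv [] A))) h
  rw [← comp_assoc, h', id_comp (by simp [cod])] at this
  exact this.symm

theorem braidInv_nil (A : List (Lab G)) : mk (braidInv A []) = mk (Term.id A) := by
  have h' : comp (mk (braidInv A [])) (mk (braid A [])) = mk (Term.id A) := by
    simpa [mk_comp] using sound (Rel.inv_braid A [])
  rwa [braid_nil, comp_id (by simp [dom])] at h'

theorem nil_braidInv (A : List (Lab G)) : mk (braidInv [] A) = mk (Term.id A) := by
  have h' : comp (mk (braidInv [] A)) (mk (braid [] A)) = mk (Term.id A) := by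
    simpa [mk_comp] using sound (Rel.inv_braid [] A)
  rwa [nil_braid, comp_id (by simp [dom])] at h'

theorem interchange {t t' s s' : Term G} (h : t.dom = t'.cod) (h' : s.dom = s'.cod) :
    comp (tensor (mk t) (mk s)) (tensor (mk t') (mk s')) =
      tensor (comp (mk t) (mk t')) (comp (mk s) (mk s')) :=
  sound (.interchange t t' s s' h h')

/-- A state `s` next to `t` may be slid below `t`. -/
theorem id_tensor_comp {A : List (Lab G)} {t s : Term G} (ht : t.cod = A) (hs : s.dom = []) :
    comp (tensor (mk (Term.id A)) (mk s)) (mk t) = tensor (mk t) (mk s) := by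
  conv_lhs => rw [← tensor_nil (mk t)]
  rw [interchange (t := Term.id A) (s' := Term.id []) ht.symm hs, id_comp ht, comp_id hs]

theorem tensor_id_comp {A : List (Lab G)} {t s : Term G} (ht : t.cod = A) (hs : s.dom = []) :
    comp (tensor (mk s) (mk (Term.id A))) (mk t) = tensor (mk s) (mk t) := by
  conv_lhs => rw [← nil_tensor (mk t)]
  rw [interchange (t' := Term.id []) (s := Term.id A) hs ht.symm, id_comp ht, comp_id hs]

/-- The antipode preserves the unit. -/
theorem anti_unit (i : G) : comp (mk (S (𝟙 i))) (mk (η i)) = mk (η i) := by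
  -- Both sides of `S * id = η ε` are evaluated on `η`: the left becomes the product of `S η` with
  -- `η`, which is `S η`, and the right becomes `η`.
  have h := congrArg (fun x => comp x (mk (η i))) (sound (Rel.ax (Ax.s1 (𝟙 i))))
  have h7 := sound (Rel.ax (Ax.a7 i))
  have h8 := sound (Rel.ax (Ax.a8 i))
  have h4 := sound (Rel.ax (Ax.a4 (Groupoid.inv (𝟙 i))))
  simp only [mk_comp, mk_tensor, comp_assoc] at h h7 h8 h4
  rw [h7, h8, comp_id (by rfl), idg, interchange (by rfl) (by rfl), id_comp (by rfl),
    ← mk_comp (S _) (η i), ← id_tensor_comp (A := [H (Groupoid.inv (𝟙 i))]) (by rfl) (by rfl),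
    ← comp_assoc] at h
  rw [idg] at h4
  rw [h4, id_comp (by rfl), mk_comp] at h
  exact h

/-- This and the following lemmas are the rewriting rules for mixed instances of the copairing
axioms, where a single unit survives from each `σ`. They are stated with `gen` because the notation
for generators is unfolded there. -/
theorem id_comp_unit (i : G) : comp (mk (Term.id [H (𝟙 i)])) (mk (gen (.unit i))) =
    mk (gen (.unit i)) := id_comp rfl

theorem comul_comp_unit (i : G) : comp (mk (gen (.comul (𝟙 i)))) (mk (gen (.unit i))) =
    tensor (mk (gen (.unit i))) (mk (gen (.unit i))) := sound (.ax (.a7 i))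

theorem counit_comp_unit (i : G) : comp (mk (gen (.counit (𝟙 i)))) (mk (gen (.unit i))) =
    mk (Term.id []) := sound (.ax (.a8 i))

theorem mul_comp_unit_tensor {i j : G} (g : i ⟶ j) : comp (mk (gen (.mul (𝟙 i) g)))
    (tensor (mk (gen (.unit i))) (mk (Term.id [H g]))) = mk (Term.id [H g]) :=
  sound (.ax (.a4' g))

theorem mul_comp_tensor_unit {i j : G} (g : i ⟶ j) : comp (mk (gen (.mul g (𝟙 j))))
    (tensor (mk (Term.id [H g])) (mk (gen (.unit j)))) = mk (Term.id [H g]) :=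
  sound (.ax (.a4 g))

theorem unit_tensor_id_comp_unit (i : G) : comp (tensor (mk (gen (.unit i)))
    (mk (Term.id [H (𝟙 i)]))) (mk (gen (.unit i))) =
    tensor (mk (gen (.unit i))) (mk (gen (.unit i))) := tensor_id_comp rfl rfl

theorem id_tensor_unit_comp_unit (i : G) : comp (tensor (mk (Term.id [H (𝟙 i)]))
    (mk (gen (.unit i)))) (mk (gen (.unit i))) =
    tensor (mk (gen (.unit i))) (mk (gen (.unit i))) := id_tensor_comp rfl rfl

theorem id_tensor_id_comp_unit_tensor_unit (i : G) :
    comp (tensor (mk (Term.id [H (𝟙 i)])) (mk (Term.id [H (𝟙 i)])))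
      (tensor (mk (gen (.unit i))) (mk (gen (.unit i)))) =
    tensor (mk (gen (.unit i))) (mk (gen (.unit i))) := by
  rw [interchange rfl rfl, id_comp_unit]

theorem mul_comp_unit_tensor_unit (i : G) : comp (mk (gen (.mul (𝟙 i) (𝟙 i))))
    (tensor (mk (gen (.unit i))) (mk (gen (.unit i)))) = mk (gen (.unit i)) := by
  rw [← unit_tensor_id_comp_unit, ← comp_assoc, mul_comp_unit_tensor, id_comp_unit]

theorem id_tensor_anti_comp_id_tensor_unit {i j : G} (g : i ⟶ j) :
    comp (tensor (mk (Term.id [H g])) (mk (gen (.anti (𝟙 j)))))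
      (tensor (mk (Term.id [H g])) (mk (gen (.unit j)))) =
    tensor (mk (Term.id [H g])) (mk (gen (.unit j))) := by
  rw [interchange rfl rfl, id_comp_id]
  exact congrArg _ (anti_unit j)

theorem anti_tensor_id_comp_unit_tensor_id {i j : G} (g : i ⟶ j) :
    comp (tensor (mk (gen (.anti (𝟙 i)))) (mk (Term.id [H g])))
      (tensor (mk (gen (.unit i))) (mk (Term.id [H g]))) =
    tensor (mk (gen (.unit i))) (mk (Term.id [H g])) := by
  rw [interchange rfl rfl, id_comp_id]
  exact congrArg (tensor · _) (anti_unit i)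

end TermClass

/-! ### Translating admissible terms back -/

theorem Lab.map_injective (φ : G ⥤ G') (hφ : Function.Injective φ.obj) [φ.Faithful] :
    Function.Injective (Lab.map φ) := by
  rintro ⟨i, j, g⟩ ⟨i', j', g'⟩ h
  simp only [Lab.map, Lab.mk.injEq] at h
  obtain ⟨hi, hj, hg⟩ := h
  cases hφ hi
  cases hφ hj
  cases φ.map_injective (eq_of_heq hg)
  rfl

theorem H_injective {i j i' j' : G} {g : i ⟶ j} {g' : i' ⟶ j'} (h : H g = H g') :
    i = i' ∧ j = j' ∧ g ≍ g' := by
  simpa using h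

theorem Gen.map_injective (φ : G ⥤ G') (hφ : Function.Injective φ.obj) [φ.Faithful] :
    Function.Injective (Gen.map φ) := by
  -- Packing source, target and morphism into one label lets `Lab.map_injective` treat the dependent
  -- equalities together.
  have key {i j i' j' : G} {g : i ⟶ j} {g' : i' ⟶ j'} (hi : φ.obj i = φ.obj i')
      (hj : φ.obj j = φ.obj j') (hg : φ.map g ≍ φ.map g') : i = i' ∧ j = j' ∧ g ≍ g' := by
    refine H_injective (Lab.map_injective φ hφ ?_)
    simp only [Lab.map, Lab.mk.injEq]
    exact ⟨hi, hj, hg⟩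
  intro e e' h
  cases e <;> cases e' <;> simp only [Gen.map, reduceCtorEq, Gen.mul.injEq, Gen.unit.injEq,
    Gen.comul.injEq, Gen.counit.injEq, Gen.anti.injEq, Gen.antiInv.injEq, Gen.coint.injEq,
    Gen.integ.injEq, Gen.rib.injEq, Gen.ribInv.injEq] at h
  case mul.mul =>
    obtain ⟨h1, h2, h3, h4, h5⟩ := h
    obtain ⟨rfl, rfl, h⟩ := key h1 h2 h4
    obtain ⟨-, rfl, h'⟩ := key rfl h3 h5
    cases h
    cases h'
    rfl
  case unit.unit => cases hφ h; rfl
  case coint.coint => cases hφ h; rfl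
  all_goals
    obtain ⟨h1, h2, h3⟩ := h
    obtain ⟨rfl, rfl, h⟩ := key h1 h2 h3
    cases h
    rfl

open Classical in
/-- The preimage of a label under `φ`, or the empty sequence. -/
noncomputable def Lab.back (φ : G ⥤ G') (a : Lab G') : List (Lab G) :=
  if h : ∃ b : Lab G, b.map φ = a then [h.choose] else []

open Classical in
/-- The preimage of an elementary morphism under `φ`, or the identity of the unit object. -/
noncomputable def Gen.back (φ : G ⥤ G') (e : Gen G') : Term G :=
  if h : ∃ b : Gen G, b.map φ = e then gen h.choose else Term.id []

/-- The preimage of a sequence of labels, omitting labels outside the image of `φ`. -/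
noncomputable def labelsBack (φ : G ⥤ G') (A : List (Lab G')) : List (Lab G) :=
  A.flatMap (Lab.back φ)

/-- Translation of terms against `φ`: labels outside the image of `φ` are interpreted in the
trivial Hopf algebra `1`. -/
noncomputable def Term.back (φ : G ⥤ G') : Term G' → Term G
  | id A => id (labelsBack φ A)
  | gen e => e.back φ
  | comp t s => comp (t.back φ) (s.back φ)
  | tensor t s => tensor (t.back φ) (s.back φ)
  | braid A B => braid (labelsBack φ A) (labelsBack φ B)
  | braidInv A B => braidInv (labelsBack φ A) (labelsBack φ B)

/-- The first object that occurs in an elementary morphism. -/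
def Gen.obj : Gen G → G
  | @mul _ _ i _ _ _ _ => i
  | unit i => i
  | @comul _ _ i _ _ => i
  | @counit _ _ i _ _ => i
  | @anti _ _ i _ _ => i
  | @antiInv _ _ i _ _ => i
  | coint i => i
  | @integ _ _ i _ _ => i
  | @rib _ _ i _ _ => i
  | @ribInv _ _ i _ _ => i

section

variable (φ : G ⥤ G')

theorem Lab.back_of_notMem {a : Lab G'} (h : a.src ∉ Set.range φ.obj) : a.back φ = [] := by
  refine dif_neg ?_
  rintro ⟨b, rfl⟩
  exact h ⟨b.src, rfl⟩

/-- One object outside the image already excludes a preimage. The first one is a sufficient test for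
admissible generators, whose objects are all inside or all outside the image. -/
theorem Gen.back_of_notMem {e : Gen G'} (h : e.obj ∉ Set.range φ.obj) :
    e.back φ = Term.id [] := by
  refine dif_neg ?_
  rintro ⟨b, rfl⟩
  apply h
  cases b <;> exact ⟨_, rfl⟩

theorem labelsBack_nil : labelsBack φ [] = [] := rfl

theorem labelsBack_cons (a : Lab G') (A : List (Lab G')) :
    labelsBack φ (a :: A) = a.back φ ++ labelsBack φ A := List.flatMap_cons

theorem labelsBack_append (A B : List (Lab G')) :
    labelsBack φ (A ++ B) = labelsBack φ A ++ labelsBack φ B := List.flatMap_append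

theorem labelsBack_of_notMem {A : List (Lab G')} (h : ∀ a ∈ A, a.src ∉ Set.range φ.obj) :
    labelsBack φ A = [] := List.flatMap_eq_nil_iff.2 fun a ha => Lab.back_of_notMem φ (h a ha)

theorem Lab.back_map (hφ : Function.Injective φ.obj) [φ.Faithful] (a : Lab G) :
    (a.map φ).back φ = [a] := by
  have h : ∃ b : Lab G, b.map φ = a.map φ := ⟨a, rfl⟩
  rw [Lab.back, dif_pos h, Lab.map_injective φ hφ h.choose_spec]

theorem Gen.back_map (hφ : Function.Injective φ.obj) [φ.Faithful] (e : Gen G) :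
    (e.map φ).back φ = gen e := by
  have h : ∃ b : Gen G, b.map φ = e.map φ := ⟨e, rfl⟩
  rw [Gen.back, dif_pos h, Gen.map_injective φ hφ h.choose_spec]

theorem labelsBack_map (hφ : Function.Injective φ.obj) [φ.Faithful] (A : List (Lab G)) : labelsBack φ (A.map (Lab.map φ)) = A := by
  induction A with
  | nil => rfl
  | cons a A ih => rw [List.map_cons, labelsBack_cons, Lab.back_map φ hφ, ih]; rfl

theorem Term.back_map (hφ : Function.Injective φ.obj) [φ.Faithful] (t : Term G) : (t.map φ).back φ = t := by
  induction t <;> simp_all [Term.map, Term.back, labelsBack_map φ hφ, Gen.back_map φ hφ]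

/-- No generator mixes the two kinds of labels: its objects are linked by its morphisms, and an
admissible morphism never joins an object of the image to one outside. -/
theorem Gen.adm_cases (hφ : Function.Injective φ.obj) {e : Gen G'} (h : LabelsAdm φ e.dom)
    (h' : LabelsAdm φ e.cod) :
    (∃ b : Gen G, b.map φ = e) ∨ ((∀ a ∈ e.dom, a.src ∉ Set.range φ.obj) ∧
      (∀ a ∈ e.cod, a.src ∉ Set.range φ.obj) ∧ e.back φ = Term.id []) := by
  cases e with
  | mul g k =>
    simp only [Gen.dom, labelsAdm_cons] at h
    obtain ⟨hg, hk, -⟩ := h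
    cases hg with
    | img g =>
      obtain ⟨b, k, rfl, e⟩ := hk.of_src hφ rfl
      cases e
      exact .inl ⟨.mul g k, rfl⟩
    | out hi hj _ =>
      refine .inr ⟨?_, ?_, Gen.back_of_notMem φ hi⟩ <;>
        simp only [Gen.dom, Gen.cod, List.forall_mem_cons, List.not_mem_nil, false_imp_iff,
          implies_true, hi, hj, and_true, true_and, not_false_eq_true]
  | unit i =>
    obtain ⟨a, rfl⟩ | hi := em (i ∈ Set.range φ.obj)
    · exact .inl ⟨.unit a, rfl⟩
    · refine .inr ⟨?_, ?_, Gen.back_of_notMem φ hi⟩ <;>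
        simp only [Gen.dom, Gen.cod, List.forall_mem_cons, List.not_mem_nil, false_imp_iff,
          implies_true, hi, and_true, not_false_eq_true]
  | coint i =>
    obtain ⟨a, rfl⟩ | hi := em (i ∈ Set.range φ.obj)
    · exact .inl ⟨.coint a, rfl⟩
    · refine .inr ⟨?_, ?_, Gen.back_of_notMem φ hi⟩ <;>
        simp only [Gen.dom, Gen.cod, List.forall_mem_cons, List.not_mem_nil, false_imp_iff,
          implies_true, hi, and_true, not_false_eq_true]
  | _ g =>
    have hg : RibbonHopf.Adm φ g := by
      -- The integral has empty source, so its label is read off the target.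
      first
      | exact ((labelsAdm_cons φ _ _).1 h).1
      | exact ((labelsAdm_cons φ _ _).1 h').1
    cases hg with
    | img g =>
      left
      first
      | exact ⟨.comul g, rfl⟩
      | exact ⟨.counit g, rfl⟩
      | exact ⟨.anti g, rfl⟩
      | exact ⟨.antiInv g, rfl⟩
      | exact ⟨.integ g, rfl⟩
      | exact ⟨.rib g, rfl⟩
      | exact ⟨.ribInv g, rfl⟩
    | out hi hj _ =>
      refine .inr ⟨?_, ?_, Gen.back_of_notMem φ hi⟩ <;>
        simp only [Gen.dom, Gen.cod, List.forall_mem_cons, List.not_mem_nil, false_imp_iff,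
          implies_true, hi, hj, and_true, true_and, not_false_eq_true]

/-- Admissibility matters here: an inadmissible generator can have boundary labels with preimages
although it is itself sent to `id []`. -/
theorem Term.back_dom_cod (hφ : Function.Injective φ.obj) [φ.Faithful] {t : Term G'}
    (h : t.Adm φ) :
    (t.back φ).dom = labelsBack φ t.dom ∧ (t.back φ).cod = labelsBack φ t.cod := by
  induction t with
  | gen e =>
    obtain ⟨b, rfl⟩ | ⟨hd, hc, hb⟩ := Gen.adm_cases φ hφ h.1 h.2
    · simp only [Term.back, Gen.back_map φ hφ, dom, cod, Gen.map_dom, Gen.map_cod,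
        labelsBack_map φ hφ, and_self]
    · simp only [Term.back, hb, dom, cod, labelsBack_of_notMem φ hd, labelsBack_of_notMem φ hc,
        and_self]
  | comp t s iht ihs => exact ⟨(ihs h.2).1, (iht h.1).2⟩
  | tensor t s iht ihs =>
    simp only [Term.back, dom, cod, labelsBack_append, iht h.1, ihs h.2, and_self]
  | id A => exact ⟨rfl, rfl⟩
  | _ A B => simp only [Term.back, dom, cod, labelsBack_append, and_self]

end

/-! ### The translation respects the axioms -/

open TermClass

section

variable {φ : G ⥤ G'}

theorem Rel.back_of_eq_map (hφ : Function.Injective φ.obj) [φ.Faithful] {t s : Term G}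
    (h : Rel t s) {t' s' : Term G'} (ht : t' = t.map φ) (hs : s' = s.map φ) :
    Rel (t'.back φ) (s'.back φ) := by
  rwa [ht, hs, back_map φ hφ, back_map φ hφ]

theorem mk_back_σ_of_notMem {i j : G'} (hi : i ∉ Set.range φ.obj) (hj : j ∉ Set.range φ.obj) :
    mk ((σ i j).back φ) = mk (Term.id []) := by
  unfold σ
  split
  · simp only [vInv, S, Δ, v, η, Term.back, mk_comp, mk_tensor,
      Gen.back_of_notMem φ (e := .ribInv (𝟙 j)) hj, Gen.back_of_notMem φ (e := .rib (𝟙 j)) hj,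
      Gen.back_of_notMem φ (e := .anti (𝟙 j)) hj, Gen.back_of_notMem φ (e := .comul (𝟙 j)) hj,
      Gen.back_of_notMem φ (e := .unit j) hj, id_comp_id, nil_tensor]
  · simp only [η, Term.back, mk_tensor, Gen.back_of_notMem φ (e := .unit i) hi,
      Gen.back_of_notMem φ (e := .unit j) hj, nil_tensor]

/-- The two indices differ, so `σ` is a product of units, and the unit at the outside object becomes
trivial. -/
theorem mk_back_σ_of_notMem_right (hφ : Function.Injective φ.obj) [φ.Faithful] (i : G) {j : G'}
    (hj : j ∉ Set.range φ.obj) : mk ((σ (φ.obj i) j).back φ) = mk (η i) := by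
  have h : φ.obj i ≠ j := fun h => hj ⟨i, h⟩
  simp only [σ, if_neg h, Term.back, mk_tensor, η, Gen.back_of_notMem φ (e := .unit j) hj,
    tensor_nil]
  rw [show Gen.unit (φ.obj i) = (Gen.unit i).map φ from rfl, Gen.back_map φ hφ]

theorem mk_back_σ_of_notMem_left (hφ : Function.Injective φ.obj) [φ.Faithful] {i : G'} (j : G)
    (hi : i ∉ Set.range φ.obj) : mk ((σ i (φ.obj j)).back φ) = mk (η j) := by
  have h : i ≠ φ.obj j := fun h => hi ⟨j, h.symm⟩
  simp only [σ, if_neg h, Term.back, mk_tensor, η, Gen.back_of_notMem φ (e := .unit i) hi,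
    nil_tensor]
  rw [show Gen.unit (φ.obj j) = (Gen.unit j).map φ from rfl, Gen.back_map φ hφ]

theorem Ax.back (hφ : Function.Injective φ.obj) [φ.Faithful] {t s : Term G'} (h : Ax t s)
    (ha : t.Adm φ) : Rel (t.back φ) (s.back φ) := by
  have hσ := map_σ φ hφ
  have hinv {i j : G} (g : i ⟶ j) : φ.map (Groupoid.inv g) = Groupoid.inv (φ.map g) := by
    simp [Groupoid.inv_eq_inv]
  -- In mixed instances identities occur as `𝟙 (φ.obj i)` rather than `φ.map (𝟙 i)`, so
  -- `Gen.back_map` is restated in that form.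
  have b1 (i : G) : Gen.back φ (.comul (𝟙 (φ.obj i))) = gen (.comul (𝟙 i)) := by
    simpa only [Gen.map, φ.map_id] using Gen.back_map φ hφ (.comul (𝟙 i))
  have b2 (i : G) : Gen.back φ (.counit (𝟙 (φ.obj i))) = gen (.counit (𝟙 i)) := by
    simpa only [Gen.map, φ.map_id] using Gen.back_map φ hφ (.counit (𝟙 i))
  have b3 (i : G) : Gen.back φ (.anti (𝟙 (φ.obj i))) = gen (.anti (𝟙 i)) := by
    simpa only [Gen.map, φ.map_id] using Gen.back_map φ hφ (.anti (𝟙 i))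
  have b4 (i : G) : Gen.back φ (.unit (φ.obj i)) = gen (.unit i) := Gen.back_map φ hφ (.unit i)
  have b5 {i j : G} (g : i ⟶ j) : Gen.back φ (.mul (φ.map g) (𝟙 (φ.obj j))) = gen (.mul g (𝟙 j)) := by
    simpa only [Gen.map, φ.map_id] using Gen.back_map φ hφ (.mul g (𝟙 j))
  have b6 {i j : G} (g : i ⟶ j) : Gen.back φ (.mul (𝟙 (φ.obj i)) (φ.map g)) = gen (.mul (𝟙 i) g) := by
    simpa only [Gen.map, φ.map_id] using Gen.back_map φ hφ (.mul (𝟙 i) g)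
  have b7 (i : G) : Gen.back φ (.mul (𝟙 (φ.obj i)) (𝟙 (φ.obj i))) = gen (.mul (𝟙 i) (𝟙 i)) := by
    simpa only [φ.map_id] using b5 (𝟙 i)
  have b8 {i j : G} (g : i ⟶ j) : Lab.back φ (H (φ.map g)) = [H g] := Lab.back_map φ hφ (H g)
  have b9 (i : G) : Lab.back φ (H (𝟙 (φ.obj i))) = [H (𝟙 i)] := by
    simpa only [φ.map_id] using b8 (𝟙 i)
  cases h <;>
    simp only [idg, m, η, Δ, ε, S, Sbar, l, L, v, vInv, γ, γbar, μ, ρl, ρr, Term.Adm, Gen.dom,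
      Gen.cod, labelsAdm_nil, labelsAdm_cons, adm_σ, and_true, true_and] at ha
  case' a1 g =>
    obtain g | ⟨hi, hj⟩ := show Adm φ g by tauto
    on_goal 1 => refine Rel.back_of_eq_map hφ (.ax (.a1 g)) ?_ ?_
  case' a2 g =>
    obtain g | ⟨hi, hj⟩ := show Adm φ g by tauto
    on_goal 1 => refine Rel.back_of_eq_map hφ (.ax (.a2 g)) ?_ ?_
  case' a2' g =>
    obtain g | ⟨hi, hj⟩ := show Adm φ g by tauto
    on_goal 1 => refine Rel.back_of_eq_map hφ (.ax (.a2' g)) ?_ ?_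
  case' a4 g =>
    obtain g | ⟨hi, hj⟩ := show Adm φ g by tauto
    on_goal 1 => refine Rel.back_of_eq_map hφ (.ax (.a4 g)) ?_ ?_
  case' a4' g =>
    obtain g | ⟨hi, hj⟩ := show Adm φ g by tauto
    on_goal 1 => refine Rel.back_of_eq_map hφ (.ax (.a4' g)) ?_ ?_
  case' s1 g =>
    obtain g | ⟨hi, hj⟩ := show Adm φ g by tauto
    on_goal 1 => refine Rel.back_of_eq_map hφ (.ax (.s1 g)) ?_ ?_
  case' s1' g =>
    obtain g | ⟨hi, hj⟩ := show Adm φ g by tauto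
    on_goal 1 => refine Rel.back_of_eq_map hφ (.ax (.s1' g)) ?_ ?_
  case' s2 g =>
    obtain g | ⟨hi, hj⟩ := show Adm φ g by tauto
    on_goal 1 => refine Rel.back_of_eq_map hφ (.ax (.s2 g)) ?_ ?_
  case' s2' g =>
    obtain g | ⟨hi, hj⟩ := show Adm φ g by tauto
    on_goal 1 => refine Rel.back_of_eq_map hφ (.ax (.s2' g)) ?_ ?_
  case' i4 g =>
    obtain g | ⟨hi, hj⟩ := show Adm φ g by tauto
    on_goal 1 => refine Rel.back_of_eq_map hφ (.ax (.i4 g)) ?_ ?_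
  case' r1 g =>
    obtain g | ⟨hi, hj⟩ := show Adm φ g by tauto
    on_goal 1 => refine Rel.back_of_eq_map hφ (.ax (.r1 g)) ?_ ?_
  case' r1' g =>
    obtain g | ⟨hi, hj⟩ := show Adm φ g by tauto
    on_goal 1 => refine Rel.back_of_eq_map hφ (.ax (.r1' g)) ?_ ?_
  case' r2 g =>
    obtain g | ⟨hi, hj⟩ := show Adm φ g by tauto
    on_goal 1 => refine Rel.back_of_eq_map hφ (.ax (.r2 g)) ?_ ?_
  case' r3 g =>
    obtain g | ⟨hi, hj⟩ := show Adm φ g by tauto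
    on_goal 1 => refine Rel.back_of_eq_map hφ (.ax (.r3 g)) ?_ ?_
  case' r4 g =>
    obtain g | ⟨hi, hj⟩ := show Adm φ g by tauto
    on_goal 1 => refine Rel.back_of_eq_map hφ (.ax (.r4 g)) ?_ ?_
  case' r10 g =>
    obtain g | ⟨hi, hj⟩ := show Adm φ g by tauto
    on_goal 1 => refine Rel.back_of_eq_map hφ (.ax (.r10 g)) ?_ ?_
  case' a5 g h =>
    have hh : Adm φ h := by tauto
    obtain g | ⟨hi, hj⟩ := show Adm φ g by tauto
    on_goal 1 =>
      obtain ⟨c, h, rfl, e⟩ := hh.of_src hφ rfl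
      cases e
      refine Rel.back_of_eq_map hφ (.ax (.a5 g h)) ?_ ?_
  case' a6 g h =>
    have hh : Adm φ h := by tauto
    obtain g | ⟨hi, hj⟩ := show Adm φ g by tauto
    on_goal 1 =>
      obtain ⟨c, h, rfl, e⟩ := hh.of_src hφ rfl
      cases e
      refine Rel.back_of_eq_map hφ (.ax (.a6 g h)) ?_ ?_
  case' i2 g h =>
    have hh : Adm φ h := by tauto
    obtain g | ⟨hi, hj⟩ := show Adm φ g by tauto
    on_goal 1 =>
      obtain ⟨c, h, rfl, e⟩ := hh.of_src hφ rfl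
      cases e
      refine Rel.back_of_eq_map hφ (.ax (.i2 g h)) ?_ ?_
  case' i2' g h =>
    have hh : Adm φ h := by tauto
    obtain g | ⟨hi, hj⟩ := show Adm φ g by tauto
    on_goal 1 =>
      obtain ⟨c, h, rfl, e⟩ := hh.of_src hφ rfl
      cases e
      refine Rel.back_of_eq_map hφ (.ax (.i2' g h)) ?_ ?_
  case' r5 g h =>
    have hh : Adm φ h := by tauto
    obtain g | ⟨hi, hj⟩ := show Adm φ g by tauto
    on_goal 1 =>
      obtain ⟨c, h, rfl, e⟩ := hh.of_src hφ rfl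
      cases e
      refine Rel.back_of_eq_map hφ (.ax (.r5 g h)) ?_ ?_
  case' r5' g h =>
    have hh : Adm φ h := by tauto
    obtain g | ⟨hi, hj⟩ := show Adm φ g by tauto
    on_goal 1 =>
      obtain ⟨c, h, rfl, e⟩ := hh.of_src hφ rfl
      cases e
      refine Rel.back_of_eq_map hφ (.ax (.r5' g h)) ?_ ?_
  case' a3 f g h =>
    have hg : Adm φ g := by tauto
    have hh : Adm φ h := by tauto
    obtain f | ⟨hi, hj⟩ := show Adm φ f by tauto
    on_goal 1 =>
      obtain ⟨c, g, rfl, e⟩ := hg.of_src hφ rfl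
      cases e
      obtain ⟨d, h, rfl, e⟩ := hh.of_src hφ rfl
      cases e
      refine Rel.back_of_eq_map hφ (.ax (.a3 f g h)) ?_ ?_
    -- The label of `h` starts at the target of `g`, which must also be known to lie outside the
    -- image.
    on_goal 3 => have hk := hg.tgt_of_src_notMem hj
  case' a7 i =>
    obtain ⟨i, rfl⟩ | hi := em (i ∈ Set.range φ.obj)
    on_goal 1 => refine Rel.back_of_eq_map hφ (.ax (.a7 i)) ?_ ?_
  case' a8 i =>
    obtain ⟨i, rfl⟩ | hi := em (i ∈ Set.range φ.obj)
    on_goal 1 => refine Rel.back_of_eq_map hφ (.ax (.a8 i)) ?_ ?_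
  case' i1 i =>
    obtain ⟨i, rfl⟩ | hi := em (i ∈ Set.range φ.obj)
    on_goal 1 => refine Rel.back_of_eq_map hφ (.ax (.i1 i)) ?_ ?_
  case' i1' i =>
    obtain ⟨i, rfl⟩ | hi := em (i ∈ Set.range φ.obj)
    on_goal 1 => refine Rel.back_of_eq_map hφ (.ax (.i1' i)) ?_ ?_
  case' i3 i =>
    obtain ⟨i, rfl⟩ | hi := em (i ∈ Set.range φ.obj)
    on_goal 1 => refine Rel.back_of_eq_map hφ (.ax (.i3 i)) ?_ ?_
  case' i3' i =>
    obtain ⟨i, rfl⟩ | hi := em (i ∈ Set.range φ.obj)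
    on_goal 1 => refine Rel.back_of_eq_map hφ (.ax (.i3' i)) ?_ ?_
  case' i5 i =>
    obtain ⟨i, rfl⟩ | hi := em (i ∈ Set.range φ.obj)
    on_goal 1 => refine Rel.back_of_eq_map hφ (.ax (.i5 i)) ?_ ?_
  -- From here on the two indices are independent, so one may lie in the image and the other
  -- outside.
  case' r8 i j =>
    obtain ⟨i, rfl⟩ | hi := em (i ∈ Set.range φ.obj) <;>
      obtain ⟨j, rfl⟩ | hj := em (j ∈ Set.range φ.obj)
    on_goal 1 => refine Rel.back_of_eq_map hφ (.ax (.r8 i j)) ?_ ?_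
  case' r8' i j =>
    obtain ⟨i, rfl⟩ | hi := em (i ∈ Set.range φ.obj) <;>
      obtain ⟨j, rfl⟩ | hj := em (j ∈ Set.range φ.obj)
    on_goal 1 => refine Rel.back_of_eq_map hφ (.ax (.r8' i j)) ?_ ?_
  case' r9 i j =>
    obtain ⟨i, rfl⟩ | hi := em (i ∈ Set.range φ.obj) <;>
      obtain ⟨j, rfl⟩ | hj := em (j ∈ Set.range φ.obj)
    on_goal 1 => refine Rel.back_of_eq_map hφ (.ax (.r9 i j)) ?_ ?_
  case' r9' i j =>
    obtain ⟨i, rfl⟩ | hi := em (i ∈ Set.range φ.obj) <;>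
      obtain ⟨j, rfl⟩ | hj := em (j ∈ Set.range φ.obj)
    on_goal 1 => refine Rel.back_of_eq_map hφ (.ax (.r9' i j)) ?_ ?_
  -- In the mixed cases `μ` and one coaction become identities, the other coaction becomes a unit,
  -- and braidings with the empty sequence vanish. What remains is multiplication by `S η = η`.
  case' r11 g h =>
    obtain g | ⟨hi, hj⟩ := (show Adm φ g by tauto) <;>
      obtain h | ⟨hk, hl⟩ := (show Adm φ h by tauto)
    on_goal 1 => refine Rel.back_of_eq_map hφ (.ax (.r11 g h)) ?_ ?_
  -- The first alternative identifies an instance inside the image with a relabelled axiom; the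
  -- second computes an outside or mixed instance among classes of terms.
  all_goals first
    | simp only [idg, m, η, Δ, ε, S, Sbar, l, L, v, vInv, γ, γbar, μ, ρl, ρr, Term.map, Gen.map,
        hσ, List.map, Lab.map, φ.map_id, φ.map_comp, hinv]
      done
    | apply exact
      simp only [idg, m, η, Δ, ε, S, Sbar, l, L, v, vInv, γ, γbar, μ, ρl, ρr, Term.back,
        mk_comp, mk_tensor, Gen.back_of_notMem φ, Gen.obj, labelsBack_cons, labelsBack_nil,
        Lab.back_of_notMem, not_false_eq_true, List.append_nil, List.nil_append, id_comp_id,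
        nil_tensor, tensor_nil, mk_back_σ_of_notMem, mk_back_σ_of_notMem_left hφ,
        mk_back_σ_of_notMem_right hφ, braid_nil, braidInv_nil, nil_braid, nil_braidInv,
        id_comp_unit, comul_comp_unit, counit_comp_unit, mul_comp_unit_tensor,
        mul_comp_tensor_unit, unit_tensor_id_comp_unit, id_tensor_unit_comp_unit,
        id_tensor_id_comp_unit_tensor_unit, mul_comp_unit_tensor_unit,
        id_tensor_anti_comp_id_tensor_unit, anti_tensor_id_comp_unit_tensor_id, *]

/-! ### Faithfulness -/

theorem Rel.back (hφ : Function.Injective φ.obj) [φ.Faithful] {t s : Term G'} (h : Rel t s)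
    (ha : t.Adm φ) : Rel (t.back φ) (s.back φ) := by
  induction h with
  | ax h => exact h.back hφ ha
  | refl => exact .refl _
  | symm h ih => exact (ih ((h.adm_iff hφ).2 ha)).symm
  -- Admissibility of the intermediate term is not given; it is carried along the derivation by
  -- `Rel.adm_iff`.
  | trans h _ ih ih' => exact (ih ha).trans (ih' ((h.adm_iff hφ).1 ha))
  | comp_congr _ _ ih ih' => exact .comp_congr (ih ha.1) (ih' ha.2)
  | tensor_congr _ _ ih ih' => exact .tensor_congr (ih ha.1) (ih' ha.2)
  | id_comp t => exact .id_comp_of (back_dom_cod φ hφ ha.2).2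
  | comp_id t => exact .comp_id_of (back_dom_cod φ hφ ha.1).1
  | comp_assoc t s r => exact .comp_assoc _ _ _
  | id_tensor_id A B => simpa only [Term.back, labelsBack_append] using Rel.id_tensor_id _ _
  | interchange t t' s s' h h' =>
    refine .interchange _ _ _ _ ?_ ?_
    · rw [(back_dom_cod φ hφ ha.1.1).1, (back_dom_cod φ hφ ha.2.1).2, h]
    · rw [(back_dom_cod φ hφ ha.1.2).1, (back_dom_cod φ hφ ha.2.2).2, h']
  | tensor_assoc t s r => exact .tensor_assoc _ _ _
  | nil_tensor t => exact .nil_tensor _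
  | tensor_nil t => exact .tensor_nil _
  | braid_natural t s =>
    have ht := back_dom_cod φ hφ ha.2.1
    have hs := back_dom_cod φ hφ ha.2.2
    simpa only [Term.back, ht, hs] using Rel.braid_natural (t.back φ) (s.back φ)
  | braid_inv A B => simpa only [Term.back, labelsBack_append] using Rel.braid_inv _ _
  | inv_braid A B => simpa only [Term.back, labelsBack_append] using Rel.inv_braid _ _
  | hexagon A B C => simpa only [Term.back, labelsBack_append] using Rel.hexagon _ _ _
  | hexagon' A B C => simpa only [Term.back, labelsBack_append] using Rel.hexagon' _ _ _

theorem Rel.of_map (hφ : Function.Injective φ.obj) [φ.Faithful] {t s : Term G}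
    (h : Rel (t.map φ) (s.map φ)) : Rel t s := by
  simpa only [back_map φ hφ] using h.back hφ (adm_map φ t)

theorem Hr.mapFunctor_faithful (hφ : Function.Injective φ.obj) [φ.Faithful] :
    (Hr.mapFunctor φ hφ).Faithful where
  map_injective {A B} f g h := by
    induction f using Hr.ind with | h t w d c => ?_
    induction g using Hr.ind with | h s x e b => ?_
    exact Quotient.sound (Rel.of_map hφ (Quotient.exact h))

theorem Hr.mapObj_injective (hφ : Function.Injective φ.obj) [φ.Faithful] :
    Function.Injective (Hr.mapObj φ) := fun _ _ h =>
  Hr.ext (List.map_injective_iff.2 (Lab.map_injective φ hφ) (congrArg Hr.labels h))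

end

end RibbonHopf

theorem mainTheorem11 {G : Type u} [Groupoid.{v} G] {G' : Type u'} [Groupoid.{v'} G']
    (φ : G ⥤ G') (hφ : Function.Injective φ.obj) :
    ∃ Υ : RibbonHopf.Hr G ⥤ RibbonHopf.Hr G', RibbonHopf.Extends φ Υ ∧
      (φ.Faithful → Υ.Faithful ∧ Function.Injective Υ.obj) :=
  ⟨RibbonHopf.Hr.mapFunctor φ hφ, RibbonHopf.Hr.mapFunctor_extends φ hφ, fun _ =>
    ⟨RibbonHopf.Hr.mapFunctor_faithful hφ, RibbonHopf.Hr.mapObj_injective hφ⟩⟩
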